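/- Let $\mathbb H$ be the quaternions, $R>0$, $\alpha>0$, $\mathbb B_R=\{q\in\mathbb H:|q|<R\}$. Fix an arbitrary imaginary unit $I\in\mathbb S=\{I\in\mathbb H: I^2=-1\}$, put $\mathbb C_I=\mathbb R+\mathbb R I$ and $\mathbb B_{r,I}=\{q\in\mathbb C_I:|q|<r\}$, and write $q=x+yI$ for $q\in\mathbb C_I$. Let $L^{2,\alpha}(\mathbb R^+,\mathbb H)$ be the space of (classes of) $\mathbb H$-valued functions that are square integrable on $(0,\infty)$ for the measure $\frac{t^\alpha e^{-t}}{\Gamma(\alpha+1)}\,dt$. Let $A^{2,\alpha}_{slice}(\mathbb B_R)$ be the space of (left) slice regular functions $f:\mathbb B_R\to\mathbb H$ with $\int_{\mathbb B_{R,I}}|f(q)|^2\,d\lambda(q)<\infty$, where $d\lambda(x+yI)=\frac{\alpha}{\pi R^2}\left(1-\frac{|q|^2}{R^2}\right)^{\alpha-1}dx\,dy$. Slice regular means: $f$ is real differentiable on $\mathbb B_R$ and, for every $J\in\mathbb S$, $f$ restricted to $\mathbb B_{R,J}$ has continuous partial derivatives with $\left(\frac{\partial}{\partial x}+J\frac{\partial}{\partial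 y}\right)f(x+yJ)=0$. For $\varphi\in L^{2,\alpha}(\mathbb R^+,\mathbb H)$ and $q\in\mathbb B_R$ let $$\mathcal A\varphi(q)=\left(1-\frac qR\right)^{-\alpha-1}\int_0^{\infty}\exp\left(\frac{tq}{q-R}\right)\varphi(t)\,\frac{t^\alpha e^{-t}}{\Gamma(\alpha+1)}\,dt ,$$ where powers with a real exponent are principal powers in the complex plane that contains the base. **Theorem.** $\mathcal A$ is a bijection of $L^{2,\alpha}(\mathbb R^+,\mathbb H)$ onto $A^{2,\alpha}_{slice}(\mathbb B_R)$, and its inverse is given, for $f\in A^{2,\alpha}_{slice}(\mathbb B_R)$, by $$\mathcal A^{-1}f(t)=\frac{\alpha}{\pi R^2}\int_{\mathbb B_{R,I}}\exp\left(\frac{t\overline q}{\overline q-R}\right)\left(1-\frac{|q|^2}{R^2}\right)^{\alpha-1}\left(1-\frac{\overline q}{R}\right)^{-\alpha-1}f(q)\,dx\,dy ,$$ where the integral is taken in the $L^2$ sense: for every $r<R$ the same integral over $\mathbb B_{r,I}$ converges absolutely for each $t>0$ and defines a function of $t$ in $L^{2,\alpha}(\mathbb R^+,\mathbb H)$, and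 these functions converge to $\mathcal A^{-1}f$ in $L^{2,\alpha}(\mathbb R^+,\mathbb H)$ as $r\to R^-$. Moreover, for almost every $t>0$ for which the integral over $\mathbb B_{R,I}$ converges absolutely, $\mathcal A^{-1}f(t)$ is equal to that integral. Finally, $\mathcal A^{-1}$ is the adjoint of $\mathcal A$: for all $\varphi\in L^{2,\alpha}(\mathbb R^+,\mathbb H)$ and $f\in A^{2,\alpha}_{slice}(\mathbb B_R)$, $$\int_{\mathbb B_{R,I}}\overline{\mathcal A\varphi(q)}\,f(q)\,d\lambda(q)=\int_0^\infty\overline{\varphi(t)}\,\mathcal A^{-1}f(t)\,\frac{t^\alpha e^{-t}}{\Gamma(\alpha+1)}\,dt .$$ -/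

import Mathlib

open MeasureTheory Filter Topology Metric
open scoped Quaternion ENNReal

noncomputable section

namespace SliceBergman

/-- The set of imaginary units of the quaternions. -/
def imagUnits : Set ℍ := {I | I * I = -1}

/-- The identification `x + i y ↦ x + y I` of `ℂ` with the slice `ℂ_I = ℝ + ℝ I`. -/
def toSlice (I : ℍ) (z : ℂ) : ℍ := (z.re : ℍ) + z.im • I

/-- The principal power `w ^ s` of a quaternion `w` (off the half-line of nonpositive reals), with
real exponent `s`, computed in the complex plane that contains `w`: if `w = x + y J` with `y > 0`
and `J` an imaginary unit, and `(x + i y) ^ s = a + i b`, then `w ^ s = a + b J`. -/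
def qpow (w : ℍ) (s : ℝ) : ℍ :=
  let p : ℂ := (⟨w.re, ‖w.im‖⟩ : ℂ) ^ (s : ℂ)
  (p.re : ℍ) + (p.im / ‖w.im‖) • w.im

/-- A function on the ball of radius `R`, extended by zero to all quaternions. -/
def extendBall {R : ℝ} (f : ball (0 : ℍ) R → ℍ) : ℍ → ℍ := Function.extend Subtype.val f 0

/-- The restriction `f_I` of `f` to the slice `ℂ_I`, as a function of `z = x + i y` in the
disc of radius `R` (and zero off this disc). -/
def restrictSlice {R : ℝ} (I : ℍ) (f : ball (0 : ℍ) R → ℍ) (z : ℂ) : ℍ :=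
  extendBall f (toSlice I z)

/-- (Left) slice regular functions on the ball of radius `R`: real differentiable functions whose
restriction to every slice has continuous partial derivatives and satisfies
`(∂/∂x + I ∂/∂y) f_I = 0`. -/
def IsSliceRegular {R : ℝ} (f : ball (0 : ℍ) R → ℍ) : Prop :=
  DifferentiableOn ℝ (extendBall f) (ball 0 R) ∧
    ∀ I ∈ imagUnits,
      ContDiffOn ℝ 1 (restrictSlice I f) (ball 0 R) ∧
      ∀ z ∈ ball (0 : ℂ) R,
        fderiv ℝ (restrictSlice I f) z 1 + I * fderiv ℝ (restrictSlice I f) z Complex.I = 0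

/-- The measure `(α / (π R²)) (1 - |z|² / R²) ^ (α - 1) dx dy` on the disc of radius `R`. -/
def discMeasure (R α : ℝ) : Measure ℂ :=
  (volume.restrict (ball (0 : ℂ) R)).withDensity fun z =>
    ENNReal.ofReal (α / (Real.pi * R ^ 2) * (1 - ‖z‖ ^ 2 / R ^ 2) ^ (α - 1))

/-- The measure `t ^ α e ^ (-t) / Γ(α + 1) dt` on the half-line `(0, ∞)`. -/
def halfLineMeasure (α : ℝ) : Measure ℝ :=
  (volume.restrict (Set.Ioi (0 : ℝ))).withDensity fun t =>
    ENNReal.ofReal (t ^ α * Real.exp (-t) / Real.Gamma (α + 1))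

/-- The slice hyperholomorphic Bergman space: the slice regular functions on the ball of radius `R`
that are square integrable on the slice `ℂ_I` for the weighted measure. -/
def bergmanSpace (R α : ℝ) (I : ℍ) : Set (ball (0 : ℍ) R → ℍ) :=
  {f | IsSliceRegular f ∧ MemLp (restrictSlice I f) 2 (discMeasure R α)}

/-- The quaternionic second Bargmann transform of `φ ∈ L²(ℝ⁺, ℍ; t ^ α e ^ (-t) / Γ(α + 1) dt)`. -/
def transform (R α : ℝ) (φ : Lp ℍ 2 (halfLineMeasure α)) (q : ball (0 : ℍ) R) : ℍ :=
  qpow (1 - (q : ℍ) / (R : ℍ)) (-α - 1) *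
    ∫ t, NormedSpace.exp ((t : ℍ) * q / (q - (R : ℍ))) * φ t ∂(halfLineMeasure α)

/-- The integrand of the inversion formula, at `q = x + y I` with `z = x + i y`:
`exp (t q̄ / (q̄ - R)) (1 - |q|² / R²) ^ (α - 1) (1 - q̄ / R) ^ (-α - 1) f(q)`. -/
def invIntegrand (R α : ℝ) (I : ℍ) (f : ball (0 : ℍ) R → ℍ) (t : ℝ) (z : ℂ) : ℍ :=
  let q : ℍ := toSlice I z
  NormedSpace.exp ((t : ℍ) * star q / (star q - (R : ℍ))) *
    (((1 - ‖q‖ ^ 2 / R ^ 2) ^ (α - 1) : ℝ) : ℍ) *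
    qpow (1 - star q / (R : ℍ)) (-α - 1) * restrictSlice I f z

/-- `(α / (π R²))` times the integral of the integrand of the inversion formula over the disc of
radius `r` in the slice `ℂ_I`; the inversion formula has `r = R`. -/
def invIntegral (R α : ℝ) (I : ℍ) (f : ball (0 : ℍ) R → ℍ) (r t : ℝ) : ℍ :=
  (α / (Real.pi * R ^ 2)) • ∫ z in ball (0 : ℂ) r, invIntegrand R α I f t z

end SliceBergman

end

/-! Write `c n = Ring.multichoose (α + 1) n = (α + 1)_n / n!`. The kernel of the transform is the
Laguerre generating function: `(1 - z)^(-α-1) exp (t z / (z - 1)) = ∑ z^n L_n(t)`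
(`hasSum_laguerre`). In the half-line space `L_n` has squared norm `c n`, while `(z/R)^n` has
squared norm `1 / c n` on the weighted disc. With `ℓ_n = L_n / √(c n)` and `e_n = √(c n) (z/R)^n`,
two orthonormal sequences, the kernel at `z / R` is therefore `∑ e_n(z) ℓ_n(t)`, and the transform
sends `∑ ℓ_n b_n` to `∑ e_n b_n`, the quaternionic coefficients standing on the right.

It is thus an isometry as soon as `ℓ_n` is complete (`eq_zero_of_integral_laguerreUnit`, by
injectivity of the Fourier transform). For surjectivity, slice regular functions are exactly the
sums `∑ q^n a_n` with coefficients common to all slices (`hasSum_of_isSliceRegular`,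
`isSliceRegular_of_hasSum`), and the `a_n` can be read off from the pairings with `e_n` on a single
slice (`integral_star_monomialUnit_mul`). Hence `f` and the transform of its adjoint image, having
the same pairings, coincide (`transform_adjointL2`).

The adjoint has kernel `∑ ℓ_n(t) star (e_n(z))`, the kernel at `star z / R`. On a disc of radius `r
< R` this series may be integrated term by term, so the truncated integral is the adjoint applied to
`f` cut off to that disc (`adjointL2_indicator_ae_eq`); continuity of the adjoint then gives the
limit `r → R`. -/

noncomputable section

namespace SliceBergman

/-! ### Orthonormal sequences in quaternion valued `L²`, with coefficients on the right. -/

section Orthonormal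

theorem inner_mul_left_eq (u a b : ℍ) : inner ℝ (u * a) b = inner ℝ a (star u * b) := by
  simp only [Quaternion.inner_def, star_mul, star_star]
  simp only [Quaternion.re_mul, Quaternion.re_star, Quaternion.imI_star, Quaternion.imJ_star,
    Quaternion.imK_star, Quaternion.imI_mul, Quaternion.imJ_mul, Quaternion.imK_mul]
  ring

theorem continuous_quaternion_star : Continuous (star : ℍ → ℍ) := continuous_star

variable {X : Type*} [MeasurableSpace X] {μ : Measure X}

theorem aestronglyMeasurable_star {f : X → ℍ} (hf : AEStronglyMeasurable f μ) :
    AEStronglyMeasurable (fun x => star (f x)) μ :=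
  continuous_quaternion_star.comp_aestronglyMeasurable hf

theorem integrable_norm_mul_norm {f g : X → ℍ} (hf : MemLp f 2 μ) (hg : MemLp g 2 μ) :
    Integrable (fun x => ‖f x‖ * ‖g x‖) μ :=
  hf.norm.integrable_mul hg.norm

theorem integrable_star_mul {f g : X → ℍ} (hf : MemLp f 2 μ) (hg : MemLp g 2 μ) :
    Integrable (fun x => star (f x) * g x) μ :=
  (integrable_norm_mul_norm hf hg).mono' ((aestronglyMeasurable_star hf.1).mul hg.1)
    (Eventually.of_forall fun x => by rw [norm_mul, Quaternion.norm_star])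

theorem memLp_mul_right {f : X → ℍ} (hf : MemLp f 2 μ) (a : ℍ) :
    MemLp (fun x => f x * a) 2 μ :=
  hf.of_le_mul (c := ‖a‖) (hf.1.mul_const a)
    (Eventually.of_forall fun x => by rw [norm_mul, mul_comm])

/-- Right linear orthonormality of a sequence of quaternion valued functions. -/
structure QOrthonormal (u : ℕ → X → ℍ) (μ : Measure X) : Prop where
  memLp : ∀ n, MemLp (u n) 2 μ
  integral_star_mul : ∀ m n, ∫ x, star (u m x) * u n x ∂μ = if m = n then 1 else 0

/-- Real inner products with all right multiples of `f` determine the quaternionic pairing. This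
lets the real Hilbert space theory of `Lp` do the quaternionic work. -/
theorem inner_toLp_mul_right {f : X → ℍ} (hf : MemLp f 2 μ) (a : ℍ) (φ : Lp ℍ 2 μ) :
    inner ℝ ((memLp_mul_right hf a).toLp _) φ = inner ℝ a (∫ x, star (f x) * φ x ∂μ) := by
  rw [L2.inner_def, ← integral_inner (integrable_star_mul hf (Lp.memLp φ))]
  refine integral_congr_ae ?_
  filter_upwards [(memLp_mul_right hf a).coeFn_toLp] with x hx
  rw [hx, inner_mul_left_eq]

namespace QOrthonormal

variable {u : ℕ → X → ℍ} (hu : QOrthonormal u μ)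
include hu

theorem integral_star_mul_toLp (m n : ℕ) (a : ℍ) :
    ∫ x, star (u m x) * ((memLp_mul_right (hu.memLp n) a).toLp _ : Lp ℍ 2 μ) x ∂μ =
      if m = n then a else 0 := by
  have : ∫ x, star (u m x) * ((memLp_mul_right (hu.memLp n) a).toLp _ : Lp ℍ 2 μ) x ∂μ =
      ∫ x, (star (u m x) * u n x) * a ∂μ := by
    refine integral_congr_ae ?_
    filter_upwards [(memLp_mul_right (hu.memLp n) a).coeFn_toLp] with x hx
    rw [hx, mul_assoc]
  rw [this, integral_mul_const_of_integrable (integrable_star_mul (hu.memLp m) (hu.memLp n)),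
    hu.integral_star_mul]
  split_ifs <;> simp

/-- The isometric embedding `a ↦ u n * a` of the quaternions into `L²`. -/
def embed (n : ℕ) : ℍ →ₗᵢ[ℝ] Lp ℍ 2 μ where
  toFun a := (memLp_mul_right (hu.memLp n) a).toLp _
  map_add' a b := by
    rw [← MemLp.toLp_add]
    exact MemLp.toLp_congr _ _ (Eventually.of_forall fun x => mul_add _ _ _)
  map_smul' c a := by
    rw [RingHom.id_apply, ← MemLp.toLp_const_smul]
    exact MemLp.toLp_congr _ _ (Eventually.of_forall fun x => mul_smul_comm _ _ _)
  norm_map' a := by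
    have h := inner_toLp_mul_right (hu.memLp n) a ((memLp_mul_right (hu.memLp n) a).toLp _)
    rw [hu.integral_star_mul_toLp, if_pos rfl, real_inner_self_eq_norm_sq,
      real_inner_self_eq_norm_sq] at h
    exact (sq_eq_sq₀ (norm_nonneg _) (norm_nonneg _)).1 h

theorem embed_coeFn (n : ℕ) (a : ℍ) : hu.embed n a =ᵐ[μ] fun x => u n x * a :=
  (memLp_mul_right (hu.memLp n) a).coeFn_toLp

theorem inner_embed (n : ℕ) (a : ℍ) (φ : Lp ℍ 2 μ) :
    inner ℝ (hu.embed n a) φ = inner ℝ a (∫ x, star (u n x) * φ x ∂μ) :=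
  inner_toLp_mul_right (hu.memLp n) a φ

theorem orthogonalFamily : OrthogonalFamily ℝ (fun _ : ℕ => ℍ) hu.embed := by
  intro m n hmn a b
  rw [inner_embed]
  have := hu.integral_star_mul_toLp m n b
  rw [if_neg hmn] at this
  change inner ℝ a (∫ x, star (u m x) *
    ((memLp_mul_right (hu.memLp n) b).toLp _ : Lp ℍ 2 μ) x ∂μ) = 0
  rw [this, inner_zero_right]

/-- The synthesis operator `b ↦ ∑ u n * b n`. -/
def synth : lp (fun _ : ℕ => ℍ) 2 →ₗᵢ[ℝ] Lp ℍ 2 μ := hu.orthogonalFamily.linearIsometry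

/-- The coefficient operator, adjoint to the synthesis operator. -/
def coeff : Lp ℍ 2 μ →L[ℝ] lp (fun _ : ℕ => ℍ) 2 :=
  ContinuousLinearMap.adjoint hu.synth.toContinuousLinearMap

theorem inner_coeff (b : lp (fun _ : ℕ => ℍ) 2) (φ : Lp ℍ 2 μ) :
    inner ℝ b (hu.coeff φ) = inner ℝ (hu.synth b) φ :=
  ContinuousLinearMap.adjoint_inner_right _ _ _

theorem coeff_apply (φ : Lp ℍ 2 μ) (n : ℕ) :
    hu.coeff φ n = ∫ x, star (u n x) * φ x ∂μ := by
  refine ext_inner_left ℝ fun a => ?_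
  have h := hu.inner_coeff (lp.single 2 n a) φ
  have h2 : hu.synth (lp.single 2 n a) = hu.embed n a :=
    hu.orthogonalFamily.linearIsometry_apply_single a
  rw [h2, inner_embed] at h
  exact (lp.inner_single_left n a (hu.coeff φ)).symm.trans h

theorem coeff_synth (b : lp (fun _ : ℕ => ℍ) 2) : hu.coeff (hu.synth b) = b :=
  ext_inner_left ℝ fun a => by rw [inner_coeff, LinearIsometry.inner_map_map]

/-- Since `coeff ∘ synth = id`, the difference of the two sides has zero coefficients, and
completeness `hc` applies. -/
theorem synth_coeff (hc : ∀ φ : Lp ℍ 2 μ, (∀ n, ∫ x, star (u n x) * φ x ∂μ = 0) → φ = 0)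
    (φ : Lp ℍ 2 μ) : hu.synth (hu.coeff φ) = φ := by
  rw [eq_comm, ← sub_eq_zero]
  refine hc _ fun n => ?_
  rw [← hu.coeff_apply, map_sub, coeff_synth, sub_self]
  rfl

/-- The partial sums converge in `L²`, hence almost everywhere along a subsequence, and there the
limit must be the pointwise sum. -/
theorem synth_ae_eq (b : lp (fun _ : ℕ => ℍ) 2) {F : X → ℍ}
    (hF : ∀ᵐ x ∂μ, HasSum (fun n => u n x * b n) (F x)) : hu.synth b =ᵐ[μ] F := by
  have h := (hu.orthogonalFamily.hasSum_linearIsometry b).tendsto_sum_nat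
  obtain ⟨ns, hns, hlim⟩ := (tendstoInMeasure_of_tendsto_Lp h).exists_seq_tendsto_ae
  have hsum : ∀ᵐ x ∂μ, ∀ N : ℕ, (∑ n ∈ Finset.range N, hu.embed n (b n) : Lp ℍ 2 μ) x =
      ∑ n ∈ Finset.range N, u n x * b n := by
    refine ae_all_iff.2 fun N => ?_
    have h1 := Lp.coeFn_finsetSum (p := 2) (Finset.range N) (fun n => hu.embed n (b n))
    have h2 : ∀ᵐ x ∂μ, ∀ n, hu.embed n (b n) x = u n x * b n :=
      ae_all_iff.2 fun n => hu.embed_coeFn n (b n)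
    filter_upwards [h1, h2] with x hx1 hx2
    rw [hx1, Finset.sum_apply]
    exact Finset.sum_congr rfl fun n _ => hx2 n
  filter_upwards [hF, hlim, hsum] with x hx1 hx2 hx3
  refine tendsto_nhds_unique hx2 ?_
  simp_rw [hx3]
  exact hx1.tendsto_sum_nat.comp hns.tendsto_atTop

end QOrthonormal

end Orthonormal

/-! ### The slices `ℂ_I` and principal powers on them. -/

section Slice

theorem imagUnits_star {I : ℍ} (hI : I ∈ imagUnits) : star I = -I ∧ ‖I‖ = 1 := by
  have h : I * I = -1 := hI
  have hn : ‖I‖ = 1 := by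
    have h1 : ‖I‖ * ‖I‖ = 1 := by rw [← norm_mul, h, norm_neg, norm_one]
    nlinarith [norm_nonneg I]
  refine ⟨?_, hn⟩
  have h2 : I * star I = 1 := by
    rw [Quaternion.self_mul_star, Quaternion.normSq_eq_norm_mul_self, hn]; simp
  have h3 : I * (-I) = 1 := by rw [mul_neg, h, neg_neg]
  have h0 : I ≠ 0 := fun h0 => by simp [h0] at hn
  exact mul_left_cancel₀ h0 (h2.trans h3.symm)

theorem imagUnits_re {I : ℍ} (hI : I ∈ imagUnits) : I.re = 0 := by
  have := congrArg (fun q : ℍ => q.re) (imagUnits_star hI).1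
  simp only [Quaternion.re_star, Quaternion.re_neg] at this
  linarith

theorem neg_mem_imagUnits {I : ℍ} (hI : I ∈ imagUnits) : -I ∈ imagUnits := by
  have : I * I = -1 := hI
  simpa [imagUnits] using this

/-- The slice parametrization as an algebra homomorphism. -/
def sliceHom (I : ℍ) (hI : I ∈ imagUnits) : ℂ →ₐ[ℝ] ℍ := Complex.liftAux I hI

theorem continuous_toSlice (I : ℍ) : Continuous (toSlice I) := by
  unfold toSlice
  exact (Quaternion.continuous_coe.comp Complex.continuous_re).add
    (Complex.continuous_im.smul continuous_const)

variable {I : ℍ} (hI : I ∈ imagUnits)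
include hI

theorem toSlice_mul (z w : ℂ) : toSlice I (z * w) = toSlice I z * toSlice I w :=
  map_mul (sliceHom I hI) z w

theorem toSlice_pow (z : ℂ) (n : ℕ) : toSlice I (z ^ n) = toSlice I z ^ n :=
  map_pow (sliceHom I hI) z n

theorem toSlice_one : toSlice I 1 = 1 := map_one (sliceHom I hI)

theorem toSlice_div (z w : ℂ) : toSlice I (z / w) = toSlice I z / toSlice I w :=
  map_div₀ (sliceHom I hI) z w

theorem toSlice_star (z : ℂ) : star (toSlice I z) = toSlice I (star z) := by
  simp [toSlice, (imagUnits_star hI).1]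

theorem toSlice_exp (z : ℂ) : toSlice I (Complex.exp z) = NormedSpace.exp (toSlice I z) := by
  rw [Complex.exp_eq_exp_ℂ]
  exact NormedSpace.map_exp (sliceHom I hI) (continuous_toSlice I) z

theorem norm_toSlice (z : ℂ) : ‖toSlice I z‖ = ‖z‖ := by
  have h : toSlice I z * star (toSlice I z) = ((‖z‖ ^ 2 : ℝ) : ℍ) := by
    rw [toSlice_star hI, ← toSlice_mul hI]
    have : z * star z = ((‖z‖ ^ 2 : ℝ) : ℂ) := by
      rw [Complex.star_def, Complex.mul_conj, Complex.normSq_eq_norm_sq]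
    rw [this]
    simp only [toSlice, Complex.ofReal_re, Complex.ofReal_im, zero_smul, add_zero]
  rw [Quaternion.self_mul_star, Quaternion.normSq_eq_norm_mul_self, ← sq] at h
  have h2 : ‖toSlice I z‖ ^ 2 = ‖z‖ ^ 2 := Quaternion.coe_injective h
  exact (sq_eq_sq₀ (norm_nonneg _) (norm_nonneg _)).1 h2

omit hI

@[simp] theorem toSlice_ofReal (I : ℍ) (x : ℝ) : toSlice I (x : ℂ) = (x : ℍ) := by
  simp [toSlice]

theorem toSlice_sub (I : ℍ) (z w : ℂ) : toSlice I (z - w) = toSlice I z - toSlice I w := by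
  simp only [toSlice, Complex.sub_re, Complex.sub_im, sub_smul, Quaternion.coe_sub]
  abel

theorem toSlice_neg_star (I : ℍ) (z : ℂ) : toSlice (-I) (star z) = toSlice I z := by
  simp [toSlice]

/-- Every quaternion lies on a slice. -/
theorem exists_eq_toSlice (q : ℍ) : ∃ J ∈ imagUnits, ∃ z : ℂ, q = toSlice J z := by
  by_cases h : q.im = 0
  · refine ⟨((Complex.I : ℂ) : ℍ), ?_, (q.re : ℂ), ?_⟩
    · change ((Complex.I : ℂ) : ℍ) * ((Complex.I : ℂ) : ℍ) = -1
      rw [← Quaternion.coeComplex_mul, Complex.I_mul_I]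
      ext <;> simp
    · rw [toSlice_ofReal]
      nth_rewrite 1 [← Quaternion.re_add_im q]
      rw [h, add_zero]
  · have hn : ‖q.im‖ ≠ 0 := norm_ne_zero_iff.2 h
    refine ⟨‖q.im‖⁻¹ • q.im, ?_, ⟨q.re, ‖q.im‖⟩, ?_⟩
    · change (‖q.im‖⁻¹ • q.im) * (‖q.im‖⁻¹ • q.im) = -1
      have h1 : q.im * q.im = -((‖q.im‖ * ‖q.im‖ : ℝ) : ℍ) := by
        have := Quaternion.self_mul_star q.im
        rw [Quaternion.star_im, mul_neg, Quaternion.normSq_eq_norm_mul_self] at this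
        rw [← this, neg_neg]
      rw [smul_mul_smul_comm, h1, ← Quaternion.coe_neg, ← Quaternion.coe_smul, smul_eq_mul]
      field_simp
      simp
    · simp only [toSlice, smul_smul, mul_inv_cancel₀ hn, one_smul]
      exact (Quaternion.re_add_im q).symm

theorem qpow_toSlice_of_nonneg {I : ℍ} (hI : I ∈ imagUnits) (w : ℂ) (hw : 0 ≤ w.im)
    (h0 : 0 < w.re) (s : ℝ) : qpow (toSlice I w) s = toSlice I (w ^ (s : ℂ)) := by
  have hre : (toSlice I w).re = w.re := by simp [toSlice, imagUnits_re hI]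
  have him : (toSlice I w).im = w.im • I := by
    have h1 := Quaternion.re_add_im (toSlice I w)
    rw [hre] at h1
    exact add_left_cancel h1
  have hn : ‖(toSlice I w).im‖ = w.im := by
    rw [him, norm_smul, (imagUnits_star hI).2, mul_one, Real.norm_of_nonneg hw]
  simp only [qpow, hre, hn]
  rw [him, smul_smul]
  -- For real `w` the imaginary term of `qpow` is multiplied by `w.im = 0`, and a real power of the
  -- positive number `w.re` is real.
  rcases hw.eq_or_lt with h | h
  · have hw' : w = (w.re : ℂ) := by apply Complex.ext <;> simp [← h]
    have h2 : (⟨w.re, w.im⟩ : ℂ) = (w.re : ℂ) := hw'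
    rw [h2, ← h, mul_zero, zero_smul, add_zero]
    nth_rewrite 2 [hw']
    rw [← Complex.ofReal_cpow h0.le, Complex.ofReal_re, toSlice_ofReal]
  · rw [div_mul_cancel₀ _ h.ne']
    rfl

/-- The lower half-plane of `ℂ_I` is the upper half-plane of `ℂ_{-I}`, and the principal power
commutes with conjugation off the negative axis. -/
theorem qpow_toSlice {I : ℍ} (hI : I ∈ imagUnits) (w : ℂ) (h0 : 0 < w.re) (s : ℝ) :
    qpow (toSlice I w) s = toSlice I (w ^ (s : ℂ)) := by
  rcases le_total 0 w.im with h | h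
  · exact qpow_toSlice_of_nonneg hI w h h0 s
  · rw [← toSlice_neg_star, qpow_toSlice_of_nonneg (neg_mem_imagUnits hI) _ (by simpa using h)
      (by simpa using h0), ← toSlice_neg_star I (w ^ (s : ℂ))]
    congr 1
    have harg : w.arg ≠ Real.pi := by
      intro h
      rw [Complex.arg_eq_pi_iff] at h
      linarith [h.1]
    rw [Complex.star_def, Complex.conj_cpow _ _ harg, Complex.conj_ofReal]

end Slice

/-! ### Power series with vector coefficients. -/

section PowerSeries

theorem hasSum_iff_of_forall_eq {E : Type*} [AddCommMonoid E] [TopologicalSpace E] {u v : ℕ → E} {x : E}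
    (h : ∀ n, u n = v n) : HasSum u x ↔ HasSum v x := by
  rw [funext h]

/-- Abel's argument: the terms are bounded at the intermediate radius `(r + R) / 2`, which leaves a
geometric majorant at `r`. -/
theorem summable_norm_mul_pow_of_summable {E : Type*} [NormedAddCommGroup E] [NormedSpace ℝ E]
    {R : ℝ} {a : ℕ → E} (h : ∀ x : ℝ, 0 ≤ x → x < R → Summable fun n => x ^ n • a n)
    {r : ℝ} (h0 : 0 ≤ r) (hr : r < R) : Summable fun n => ‖a n‖ * r ^ n := by
  set s := (r + R) / 2 with hs
  have hs0 : 0 < s := by linarith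
  have hrs : r < s := by linarith
  obtain ⟨C, hC⟩ := (h s hs0.le (by linarith)).tendsto_atTop_zero.norm.bddAbove_range
  refine Summable.of_nonneg_of_le (fun n => by positivity) (fun n => ?_)
    ((summable_geometric_of_lt_one (div_nonneg h0 hs0.le) ((div_lt_one hs0).2 hrs)).mul_left C)
  have hn : ‖s ^ n • a n‖ ≤ C := hC ⟨n, rfl⟩
  rw [norm_smul, Real.norm_of_nonneg (by positivity)] at hn
  rw [div_pow, ← mul_div_assoc, le_div_iff₀ (by positivity)]
  calc ‖a n‖ * r ^ n * s ^ n = (s ^ n * ‖a n‖) * r ^ n := by ring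
    _ ≤ C * r ^ n := by gcongr

theorem le_radius_of_norm_le {𝕜 E F : Type*} [NontriviallyNormedField 𝕜] [NormedAddCommGroup E]
    [NormedSpace 𝕜 E] [NormedAddCommGroup F] [NormedSpace 𝕜 F] {R : ℝ} {a : ℕ → ℝ}
    (p : FormalMultilinearSeries 𝕜 E F) (hp : ∀ n, ‖p n‖ ≤ a n)
    (hs : ∀ r, 0 ≤ r → r < R → Summable fun n => a n * r ^ n) :
    ENNReal.ofReal R ≤ p.radius := by
  refine ENNReal.le_of_forall_nnreal_lt fun r hr => ?_
  have hr' : (r : ℝ) < R := by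
    rw [ENNReal.ofReal, ENNReal.coe_lt_coe] at hr
    exact Real.lt_toNNReal_iff_coe_lt.1 hr
  refine p.le_radius_of_summable_norm ((hs r r.2 hr').of_nonneg_of_le (fun n => by positivity) ?_)
  exact fun n => mul_le_mul_of_nonneg_right (hp n) (by positivity)

theorem hasFPowerSeriesOnBall_mkPiRing {𝕜 E : Type*} [NontriviallyNormedField 𝕜]
    [NormedAddCommGroup E] [NormedSpace 𝕜 E] {R : ℝ} (hR : 0 < R) {a : ℕ → E} {F : 𝕜 → E}
    (hs : ∀ r, 0 ≤ r → r < R → Summable fun n => ‖a n‖ * r ^ n)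
    (hF : ∀ z, ‖z‖ < R → HasSum (fun n => z ^ n • a n) (F z)) :
    HasFPowerSeriesOnBall F (fun n => ContinuousMultilinearMap.mkPiRing 𝕜 (Fin n) (a n)) 0
      (ENNReal.ofReal R) where
  r_le := le_radius_of_norm_le _
    (fun n => (ContinuousMultilinearMap.norm_mkPiRing (𝕜 := 𝕜) (ι := Fin n) (a n)).le) hs
  r_pos := by simpa using hR
  hasSum := by
    intro y hy
    rw [Metric.eball_ofReal, mem_ball_zero_iff] at hy
    simpa using hF y hy

theorem powerSeries_coeff_eq_zero {E : Type*} [NormedAddCommGroup E] [NormedSpace ℝ E]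
    {R : ℝ} (hR : 0 < R) {a : ℕ → E} (h : ∀ x : ℝ, |x| < R → HasSum (fun n => x ^ n • a n) 0)
    (n : ℕ) : a n = 0 := by
  have hp := hasFPowerSeriesOnBall_mkPiRing (𝕜 := ℝ) hR (F := fun _ => 0)
    (fun r => summable_norm_mul_pow_of_summable
      (fun x hx hxR => (h x (by rwa [abs_of_nonneg hx])).summable)) h
  have := congrFun hp.hasFPowerSeriesAt.eq_zero n
  have h2 := congrArg (fun q => q (fun _ => (1 : ℝ))) this
  simpa using h2

end PowerSeries

/-! ### The quaternions as a complex vector space through left multiplication by a slice. -/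

section SliceMod

/-- The quaternions as a complex normed space: complex scalars act by left multiplication by
the corresponding elements of a slice. -/
def SliceMod (_ : imagUnits) : Type := ℍ

variable {I : imagUnits}

instance : NormedAddCommGroup (SliceMod I) := inferInstanceAs (NormedAddCommGroup ℍ)

instance : CompleteSpace (SliceMod I) := inferInstanceAs (CompleteSpace ℍ)

instance : Module ℍ (SliceMod I) := inferInstanceAs (Module ℍ ℍ)

instance : Module ℂ (SliceMod I) :=
  Module.compHom (SliceMod I) (sliceHom I.1 I.2 : ℂ →+* ℍ)

/-- A quaternion as an element of the complex normed space attached to a slice. -/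
def SliceMod.of (I : imagUnits) (q : ℍ) : SliceMod I := q

/-- The quaternion underlying an element of the complex normed space attached to a slice. -/
def SliceMod.val (q : SliceMod I) : ℍ := q

theorem SliceMod.val_smul (z : ℂ) (q : SliceMod I) : (z • q).val = toSlice I.1 z * q.val := rfl

theorem SliceMod.norm_val (q : SliceMod I) : ‖q.val‖ = ‖q‖ := rfl

theorem SliceMod.hasSum_val_iff {u : ℕ → SliceMod I} {q : SliceMod I} :
    HasSum (fun n => (u n).val) q.val ↔ HasSum u q := Iff.rfl

instance : NormedSpace ℂ (SliceMod I) where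
  norm_smul_le z q := by
    rw [← SliceMod.norm_val, SliceMod.val_smul, norm_mul, norm_toSlice I.2, SliceMod.norm_val]

/-- The real linear map `h ↦ h d`, with `h` in a slice. -/
def sliceMulCLM (I : imagUnits) (d : ℍ) : ℂ →L[ℝ] ℍ :=
  LinearMap.toContinuousLinearMap
    ((LinearMap.mulRight ℝ d).comp (sliceHom I.1 I.2).toLinearMap)

theorem sliceMulCLM_apply (I : imagUnits) (d : ℍ) (h : ℂ) :
    sliceMulCLM I d h = toSlice I.1 h * d := rfl

/-- Both notions unfold to the same little-o estimate, so one-variable complex analysis applies to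
functions satisfying the slice Cauchy–Riemann equation. -/
theorem hasDerivAt_sliceMod_iff (I : imagUnits) (f : ℂ → ℍ) (d : ℍ) (z : ℂ) :
    HasDerivAt (fun w => SliceMod.of I (f w)) (SliceMod.of I d) z ↔
      HasFDerivAt f (sliceMulCLM I d) z := by
  rw [hasDerivAt_iff_isLittleO, hasFDerivAt_iff_isLittleO]
  exact Iff.rfl

end SliceMod

/-! ### Slice regular functions are the power series with right coefficients. -/

section Regular

variable {R : ℝ}

theorem extendBall_apply (f : ball (0 : ℍ) R → ℍ) (q : ball (0 : ℍ) R) : extendBall f q = f q :=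
  Subtype.val_injective.extend_apply f 0 q

theorem extendBall_of_mem (f : ball (0 : ℍ) R → ℍ) {q : ℍ} (hq : q ∈ ball (0 : ℍ) R) :
    extendBall f q = f ⟨q, hq⟩ :=
  extendBall_apply f ⟨q, hq⟩

theorem toSlice_mem_ball {I : ℍ} (hI : I ∈ imagUnits) {z : ℂ} :
    toSlice I z ∈ ball (0 : ℍ) R ↔ z ∈ ball (0 : ℂ) R := by
  rw [mem_ball_zero_iff, mem_ball_zero_iff, norm_toSlice hI]

theorem slice_hasSum_of_isSliceRegular {f : ball (0 : ℍ) R → ℍ} (hf : IsSliceRegular f)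
    (I : imagUnits) : ∃ a : ℕ → ℍ, ∀ z ∈ ball (0 : ℂ) R,
      HasSum (fun n => toSlice I.1 z ^ n * a n) (restrictSlice I.1 f z) := by
  obtain ⟨hC, hcr⟩ := hf.2 I.1 I.2
  have hd : DifferentiableOn ℂ (fun w => SliceMod.of I (restrictSlice I.1 f w)) (ball 0 R) := by
    intro z hz
    have h1 : DifferentiableAt ℝ (restrictSlice I.1 f) z :=
      (hC.differentiableOn one_ne_zero).differentiableAt (isOpen_ball.mem_nhds hz)
    set D := fderiv ℝ (restrictSlice I.1 f) z with hD
    have hII : I.1 * I.1 = -1 := I.2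
    have h2 : D Complex.I = I.1 * D 1 := by
      have := congrArg (fun q => I.1 * q) (hcr z hz)
      simp only [mul_add, mul_zero, ← mul_assoc, hII, neg_mul, one_mul] at this
      exact (sub_eq_zero.1 (by rw [sub_eq_add_neg]; exact this)).symm
    -- The Cauchy–Riemann equation, in the form `D i = I * D 1`, says that `D` is complex linear for
    -- the left action of the slice.
    have h3 : D = sliceMulCLM I (D 1) := by
      ext1 h
      rw [sliceMulCLM_apply]
      have : h = h.re • (1 : ℂ) + h.im • Complex.I := by
        apply Complex.ext <;> simp
      conv_lhs => rw [this, map_add, map_smul, map_smul, h2]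
      rw [toSlice, add_mul, smul_mul_assoc, Quaternion.coe_mul_eq_smul]
    have h4 := h1.hasFDerivAt
    rw [← hD, h3, ← hasDerivAt_sliceMod_iff] at h4
    exact h4.differentiableAt.differentiableWithinAt
  refine ⟨fun n => ((n.factorial : ℂ)⁻¹ •
    iteratedDeriv n (fun w => SliceMod.of I (restrictSlice I.1 f w)) 0).val, fun z hz => ?_⟩
  have h := SliceMod.hasSum_val_iff.2 (Complex.hasSum_taylorSeries_on_ball hd hz)
  refine (hasSum_iff_of_forall_eq fun n => ?_).1 h
  rw [sub_zero, smul_comm, SliceMod.val_smul, toSlice_pow I.2]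

/-- All slices share the real axis, and the values of `f` there determine the Taylor coefficients;
so these do not depend on the slice. -/
theorem hasSum_of_isSliceRegular (hR : 0 < R) {f : ball (0 : ℍ) R → ℍ} (hf : IsSliceRegular f) :
    ∃ a : ℕ → ℍ, ∀ q : ball (0 : ℍ) R, HasSum (fun n => (q : ℍ) ^ n * a n) (f q) := by
  choose a ha using fun I => slice_hasSum_of_isSliceRegular hf I
  have hreal : ∀ (I : imagUnits) (x : ℝ), |x| < R →
      HasSum (fun n => x ^ n • a I n) (extendBall f (x : ℍ)) := by
    intro I x hx
    have := ha I (x : ℂ) (by simpa using hx)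
    rw [restrictSlice, toSlice_ofReal] at this
    simpa only [← Quaternion.coe_pow, Quaternion.coe_mul_eq_smul] using this
  have heq : ∀ (I J : imagUnits) (n : ℕ), a I n = a J n := by
    intro I J n
    rw [← sub_eq_zero]
    refine powerSeries_coeff_eq_zero hR (a := fun n => a I n - a J n) (fun x hx => ?_) n
    simpa only [smul_sub, sub_self] using (hreal I x hx).sub (hreal J x hx)
  obtain ⟨I₀, hI₀, -⟩ := exists_eq_toSlice 0
  refine ⟨a ⟨I₀, hI₀⟩, fun q => ?_⟩
  obtain ⟨J, hJ, z, hz⟩ := exists_eq_toSlice (q : ℍ)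
  have hq := q.2
  rw [hz, toSlice_mem_ball hJ] at hq
  have := ha ⟨J, hJ⟩ z hq
  rw [restrictSlice, ← hz, extendBall_apply] at this
  simpa only [heq ⟨J, hJ⟩ ⟨I₀, hI₀⟩] using this

theorem summable_coeff_of_hasSum {f : ball (0 : ℍ) R → ℍ} {a : ℕ → ℍ}
    (h : ∀ q : ball (0 : ℍ) R, HasSum (fun n => (q : ℍ) ^ n * a n) (f q)) (r : ℝ) (h0 : 0 ≤ r)
    (hr : r < R) : Summable fun n => ‖a n‖ * r ^ n := by
  refine summable_norm_mul_pow_of_summable (fun x hx hxR => ?_) h0 hr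
  have := (h ⟨(x : ℍ), by simpa [abs_of_nonneg hx] using hxR⟩).summable
  simpa only [← Quaternion.coe_pow, Quaternion.coe_mul_eq_smul] using this

/-- The terms `q^n * a n` come from real multilinear maps on `ℍ`, which gives real analyticity on
the ball. On each slice the same series is a complex power series in `SliceMod`, which gives the
Cauchy–Riemann equation. -/
theorem isSliceRegular_of_hasSum (hR : 0 < R) {f : ball (0 : ℍ) R → ℍ} {a : ℕ → ℍ}
    (h : ∀ q : ball (0 : ℍ) R, HasSum (fun n => (q : ℍ) ^ n * a n) (f q)) :
    IsSliceRegular f := by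
  have hs := summable_coeff_of_hasSum h
  let p : FormalMultilinearSeries ℝ ℍ ℍ := fun n =>
    ((ContinuousLinearMap.mul ℝ ℍ).flip (a n)).compContinuousMultilinearMap
      (ContinuousMultilinearMap.mkPiAlgebraFin ℝ n ℍ)
  have hp : HasFPowerSeriesOnBall (extendBall f) p 0 (ENNReal.ofReal R) :=
    { r_le := by
        refine le_radius_of_norm_le p (fun n => ?_) hs
        refine (ContinuousLinearMap.norm_compContinuousMultilinearMap_le _ _).trans ?_
        rw [ContinuousMultilinearMap.norm_mkPiAlgebraFin, mul_one]
        refine ContinuousLinearMap.opNorm_le_bound _ (norm_nonneg _) fun q => ?_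
        simp [mul_comm]
      r_pos := by simpa using hR
      hasSum := by
        intro y hy
        rw [Metric.eball_ofReal] at hy
        rw [zero_add, extendBall_of_mem f hy]
        simpa [p] using h ⟨y, hy⟩ }
  have han : ContDiffOn ℝ 1 (extendBall f) (ball 0 R) := by
    have := hp.analyticOnNhd.contDiffOn (n := 1)
    rw [Metric.eball_ofReal] at this
    exact this (Metric.isOpen_ball.uniqueDiffOn)
  refine ⟨han.differentiableOn one_ne_zero, fun I hI => ⟨?_, fun z hz => ?_⟩⟩
  · refine han.comp (t := ball 0 R) ?_ fun z hz => (toSlice_mem_ball hI).2 hz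
    have : toSlice I = sliceMulCLM ⟨I, hI⟩ 1 := by
      ext1 z; rw [sliceMulCLM_apply, mul_one]
    rw [this]
    exact (sliceMulCLM ⟨I, hI⟩ 1).contDiff.contDiffOn
  · set J : imagUnits := ⟨I, hI⟩ with hJ
    have hq := hasFPowerSeriesOnBall_mkPiRing (𝕜 := ℂ) hR (a := fun n => SliceMod.of J (a n))
      (F := fun w => SliceMod.of J (restrictSlice I f w)) hs (fun w hw => by
        have hw' : toSlice I w ∈ ball (0 : ℍ) R := by
          rw [toSlice_mem_ball hI]; simpa using hw
        have := h ⟨_, hw'⟩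
        rw [← extendBall_of_mem f hw'] at this
        refine SliceMod.hasSum_val_iff.1 ((hasSum_iff_of_forall_eq fun n => ?_).1 this)
        rw [SliceMod.val_smul, toSlice_pow hI]
        rfl)
    have hdiff := hq.differentiableOn
    rw [Metric.eball_ofReal] at hdiff
    obtain ⟨d, hd⟩ : ∃ d : ℍ, HasFDerivAt (restrictSlice I f) (sliceMulCLM J d) z :=
      ⟨_, (hasDerivAt_sliceMod_iff J (restrictSlice I f) _ z).1
        (hdiff.differentiableAt (isOpen_ball.mem_nhds hz)).hasDerivAt⟩
    rw [hd.fderiv, sliceMulCLM_apply, sliceMulCLM_apply, toSlice_one hI]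
    have hI1 : toSlice I Complex.I = I := by simp [toSlice]
    have hII : I * I = -1 := hI
    rw [hI1, one_mul, ← mul_assoc, hII, neg_one_mul, add_neg_cancel]

end Regular

/-! ### The binomial series with coefficients `Ring.multichoose`. -/

section Binomial

theorem hasSum_of_eq {E : Type*} [AddCommMonoid E] [TopologicalSpace E] {u v : ℕ → E} {x y : E}
    (hu : HasSum u x) (h : ∀ n, v n = u n) (hxy : y = x) : HasSum v y := by
  rwa [hxy, funext h]

theorem multichoose_eq_div (a : ℝ) (n : ℕ) :
    Ring.multichoose a n = (ascPochhammer ℝ n).eval a / n.factorial := by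
  have h := Ring.factorial_nsmul_multichoose_eq_ascPochhammer a n
  rw [Polynomial.ascPochhammer_smeval_eq_eval, nsmul_eq_mul] at h
  rw [eq_div_iff (by positivity), mul_comm, h]

theorem multichoose_pos {a : ℝ} (ha : 0 < a) (n : ℕ) : 0 < Ring.multichoose a n := by
  rw [multichoose_eq_div]
  exact div_pos (ascPochhammer_pos n a ha) (by positivity)

theorem hasSum_multichoose_mul_pow (b : ℝ) {z : ℂ} (hz : ‖z‖ < 1) :
    HasSum (fun m : ℕ => ((Ring.multichoose b m : ℝ) : ℂ) * z ^ m) ((1 - z) ^ (-(b : ℂ))) := by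
  have h := (Complex.one_div_one_sub_cpow_hasFPowerSeriesOnBall_zero (b : ℂ)).hasSum (y := z)
    (by rw [← ENNReal.ofReal_one, Metric.eball_ofReal]; simpa using hz)
  rw [zero_add, one_div, ← Complex.cpow_neg] at h
  refine (hasSum_iff_of_forall_eq fun m => ?_).1 h
  have hc : Ring.choose ((b : ℂ) + m - 1) m = ((Ring.multichoose b m : ℝ) : ℂ) := by
    have : Ring.choose (b + m - 1) m = Ring.multichoose b m := by
      unfold Ring.choose
      congr 1
      ring
    rw [← this, Complex.ofReal_choose]
    push_cast
    rfl
  simp [hc, FormalMultilinearSeries.ofScalars, mul_comm]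

theorem hasSum_multichoose_mul_pow_real (b : ℝ) {x : ℝ} (h0 : 0 ≤ x) (hx : x < 1) :
    HasSum (fun m : ℕ => Ring.multichoose b m * x ^ m) ((1 - x) ^ (-b)) := by
  have h := hasSum_multichoose_mul_pow b (z := (x : ℂ)) (by simpa [abs_of_nonneg h0] using hx)
  rw [← Complex.hasSum_ofReal, Complex.ofReal_cpow (by linarith)]
  push_cast
  exact h

end Binomial

/-! ### The generating function of the Laguerre polynomials. -/

section Laguerre

/-- The generalized Laguerre polynomials. -/
def laguerre (α : ℝ) (n : ℕ) (t : ℝ) : ℝ :=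
  ∑ p ∈ Finset.HasAntidiagonal.antidiagonal n,
    (-t) ^ p.1 / p.1.factorial * Ring.multichoose (α + 1 + p.1) p.2

/-- The generating function of the Laguerre polynomials. -/
def laguerreKernel (α t : ℝ) (z : ℂ) : ℂ :=
  (1 - z) ^ (-(α : ℂ) - 1) * Complex.exp (t * z / (z - 1))

/-- Expand the exponential in powers of `-t z / (1 - z)`, then each `(1 - z)^(-α-1-k)` by the
binomial series. The resulting double series converges absolutely, and regrouping it by total degree
in `z` produces the Laguerre polynomials. -/
theorem hasSum_laguerre {α : ℝ} (hα : 0 < α) (t : ℝ) {z : ℂ} (hz : ‖z‖ < 1) :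
    HasSum (fun n : ℕ => z ^ n * (laguerre α n t : ℂ)) (laguerreKernel α t z) := by
  have hz1 : 1 - z ≠ 0 := by
    intro h
    rw [← sub_eq_zero.1 h] at hz
    simp at hz
  have hx1 : 0 < 1 - ‖z‖ := by linarith
  let F : ℕ × ℕ → ℂ := fun p =>
    (((-t) ^ p.1 / p.1.factorial * Ring.multichoose (α + 1 + p.1) p.2 : ℝ) : ℂ) * z ^ (p.1 + p.2)
  have hrow : ∀ k, HasSum (fun m => F (k, m))
      ((1 - z) ^ (-(α : ℂ) - 1) * ((t * z / (z - 1)) ^ k / k.factorial)) := by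
    intro k
    have h := (hasSum_multichoose_mul_pow (α + 1 + k) hz).mul_left
      ((((-t) ^ k / k.factorial : ℝ) : ℂ) * z ^ k)
    refine hasSum_of_eq h (fun m => ?_) ?_
    · simp only [F]
      push_cast
      ring
    · have : (1 - z) ^ (-((α + 1 + k : ℝ) : ℂ)) = (1 - z) ^ (-(α : ℂ) - 1) / (1 - z) ^ k := by
        rw [← Complex.cpow_natCast, ← Complex.cpow_sub _ _ hz1]
        congr 1
        push_cast
        ring
      rw [this]
      have h2 : (t : ℂ) * z / (z - 1) = -t * z / (1 - z) := by
        rw [← neg_sub 1 z, div_neg, neg_mul, neg_div]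
      rw [h2, div_pow, mul_pow]
      push_cast
      field_simp
  have hrow' : ∀ k, HasSum (fun m => ‖F (k, m)‖)
      ((1 - ‖z‖) ^ (-(α + 1)) * ((|t| * ‖z‖ / (1 - ‖z‖)) ^ k / k.factorial)) := by
    intro k
    have h := (hasSum_multichoose_mul_pow_real (α + 1 + k) (norm_nonneg z) hz).mul_left
      (|t| ^ k / k.factorial * ‖z‖ ^ k)
    refine hasSum_of_eq h (fun m => ?_) ?_
    · have := multichoose_pos (a := α + 1 + k) (by positivity) m
      simp only [F, norm_mul, Complex.norm_real, norm_pow, norm_div, norm_neg, Real.norm_eq_abs,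
        Nat.abs_cast, abs_of_pos this, pow_add]
      ring
    · have : (1 - ‖z‖) ^ (-(α + 1 + k)) = (1 - ‖z‖) ^ (-(α + 1)) / (1 - ‖z‖) ^ k := by
        rw [← Real.rpow_natCast, ← Real.rpow_sub hx1]
        congr 1
        ring
      rw [this, div_pow, mul_pow]
      field_simp
  -- The sums of norms over the rows are again terms of an exponential series, at `|t| ‖z‖ / (1 -
  -- ‖z‖)`.
  have hsum : Summable F := by
    refine Summable.of_norm ((summable_prod_of_nonneg fun p => norm_nonneg _).2
      ⟨fun k => (hrow' k).summable, ?_⟩)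
    simp_rw [fun k => (hrow' k).tsum_eq]
    exact (Real.summable_pow_div_factorial _).mul_left _
  have hexp : HasSum (fun k : ℕ => (1 - z) ^ (-(α : ℂ) - 1) *
      ((t * z / (z - 1)) ^ k / k.factorial)) (laguerreKernel α t z) := by
    refine HasSum.mul_left _ ?_
    rw [Complex.exp_eq_exp_ℂ]
    refine hasSum_of_eq (NormedSpace.exp_series_hasSum_exp' (𝕂 := ℂ) _) (fun k => ?_) rfl
    rw [smul_eq_mul, div_eq_inv_mul]
  have hF : HasSum F (laguerreKernel α t z) := by
    have h1 := hsum.hasSum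
    have h2 := h1.prod_fiberwise hrow
    rwa [h2.unique hexp] at h1
  have h3 := (Finset.HasAntidiagonal.sigmaAntidiagonalEquivProd.hasSum_iff).2 hF
  have h4 := h3.sigma fun n => hasSum_fintype _
  refine (hasSum_iff_of_forall_eq fun n => ?_).1 h4
  rw [laguerre, Complex.ofReal_sum, Finset.mul_sum, Finset.univ_eq_attach,
    ← Finset.sum_attach (Finset.HasAntidiagonal.antidiagonal n)]
  refine Finset.sum_congr rfl fun p _ => ?_
  have hp : p.1.1 + p.1.2 = n := Finset.HasAntidiagonal.mem_antidiagonal.1 p.2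
  simp only [F, Function.comp, Finset.HasAntidiagonal.sigmaAntidiagonalEquivProd_apply]
  rw [hp, mul_comm]

end Laguerre

/-! ### Moments of the half-line measure and orthogonality of the Laguerre polynomials. -/

section Moments

theorem Gamma_add_nat {x : ℝ} (hx : 0 < x) (n : ℕ) :
    Real.Gamma (x + n) = (ascPochhammer ℝ n).eval x * Real.Gamma x := by
  induction n with
  | zero => simp
  | succ n ih =>
    have : x + (n + 1 : ℕ) = (x + n) + 1 := by push_cast; ring
    rw [this, Real.Gamma_add_one (by positivity), ih, ascPochhammer_succ_eval]
    ring

theorem ascPochhammer_eval_add (x : ℝ) (m n : ℕ) :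
    (ascPochhammer ℝ (m + n)).eval x =
      (ascPochhammer ℝ m).eval x * (ascPochhammer ℝ n).eval (x + m) := by
  rw [← ascPochhammer_mul]
  simp [Polynomial.eval_comp]

theorem measurable_halfLine_density (α : ℝ) : Measurable fun t : ℝ =>
    ENNReal.ofReal (t ^ α * Real.exp (-t) / Real.Gamma (α + 1)) := by
  fun_prop

theorem halfLine_density_nonneg {α t : ℝ} (hα : 0 < α) (ht : 0 < t) :
    0 ≤ t ^ α * Real.exp (-t) / Real.Gamma (α + 1) :=
  div_nonneg (by positivity) (Real.Gamma_pos_of_pos (by linarith)).le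

theorem integrable_halfLine_iff {E : Type*} [NormedAddCommGroup E] [NormedSpace ℝ E] {α : ℝ}
    (hα : 0 < α) (f : ℝ → E) : Integrable f (halfLineMeasure α) ↔
      IntegrableOn (fun t => (t ^ α * Real.exp (-t) / Real.Gamma (α + 1)) • f t) (Set.Ioi 0) := by
  rw [halfLineMeasure, integrable_withDensity_iff_integrable_smul'
    (measurable_halfLine_density α) (Eventually.of_forall fun _ => ENNReal.ofReal_lt_top),
    IntegrableOn]
  refine integrable_congr ?_
  filter_upwards [ae_restrict_mem measurableSet_Ioi] with t ht
  rw [ENNReal.toReal_ofReal (halfLine_density_nonneg hα ht)]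

theorem integral_halfLine {E : Type*} [NormedAddCommGroup E] [NormedSpace ℝ E] {α : ℝ}
    (hα : 0 < α) (f : ℝ → E) : ∫ t, f t ∂(halfLineMeasure α) =
      ∫ t in Set.Ioi 0, (t ^ α * Real.exp (-t) / Real.Gamma (α + 1)) • f t := by
  rw [halfLineMeasure, integral_withDensity_eq_integral_toReal_smul
    (measurable_halfLine_density α) (Eventually.of_forall fun _ => ENNReal.ofReal_lt_top)]
  refine integral_congr_ae ?_
  filter_upwards [ae_restrict_mem measurableSet_Ioi] with t ht
  rw [ENNReal.toReal_ofReal (halfLine_density_nonneg hα ht)]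

variable {α : ℝ} (hα : 0 < α)
include hα

omit hα in
theorem halfLine_density_mul_pow (j : ℕ) {t : ℝ} (ht : 0 < t) :
    (t ^ α * Real.exp (-t) / Real.Gamma (α + 1)) • t ^ j =
      (Real.Gamma (α + 1))⁻¹ * (Real.exp (-t) * t ^ (α + 1 + j - 1)) := by
  have : α + 1 + j - 1 = α + j := by ring
  rw [this, Real.rpow_add ht, Real.rpow_natCast, smul_eq_mul]
  ring

theorem integrable_pow_halfLine (j : ℕ) : Integrable (fun t => t ^ j) (halfLineMeasure α) := by
  rw [integrable_halfLine_iff hα]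
  refine ((Real.GammaIntegral_convergent (s := α + 1 + j) (by positivity)).const_mul
    (Real.Gamma (α + 1))⁻¹).congr ?_
  filter_upwards [ae_restrict_mem measurableSet_Ioi] with t ht
  exact (halfLine_density_mul_pow j ht).symm

theorem integral_pow_halfLine (j : ℕ) :
    ∫ t, t ^ j ∂(halfLineMeasure α) = (ascPochhammer ℝ j).eval (α + 1) := by
  rw [integral_halfLine hα, setIntegral_congr_fun measurableSet_Ioi
    (fun t ht => halfLine_density_mul_pow j ht), integral_const_mul,
    ← Real.Gamma_eq_integral (by positivity), Gamma_add_nat (by positivity)]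
  have := (Real.Gamma_pos_of_pos (show 0 < α + 1 by positivity)).ne'
  field_simp

instance isFiniteMeasure_halfLine [h : Fact (0 < α)] : IsFiniteMeasure (halfLineMeasure α) := by
  have := integrable_pow_halfLine h.out 0
  simp only [pow_zero] at this
  rwa [integrable_const_iff_isFiniteMeasure one_ne_zero] at this

theorem integrable_pow_mul_laguerre (j n : ℕ) :
    Integrable (fun t => t ^ j * laguerre α n t) (halfLineMeasure α) := by
  simp only [laguerre, Finset.mul_sum]
  refine integrable_finsetSum _ fun p _ => ?_
  refine ((integrable_pow_halfLine hα (j + p.1)).const_mul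
    ((-1) ^ p.1 / p.1.factorial * Ring.multichoose (α + 1 + p.1) p.2)).congr
    (Eventually.of_forall fun t => ?_)
  simp only
  rw [neg_pow t]
  ring

/-- Inserting the moments `(α + 1)_(j + k)` gives, up to a factor, the alternating binomial sum of
`(α + 1 + k)_j` over `k`, an `n`-th forward difference of a monic polynomial of degree `j`. It is
`0` for `j < n` and `n!` for `j = n`. -/
theorem integral_pow_mul_laguerre {j n : ℕ} (hj : j ≤ n) :
    ∫ t, t ^ j * laguerre α n t ∂(halfLineMeasure α) =
      if j = n then (-1) ^ n * (ascPochhammer ℝ n).eval (α + 1) else 0 := by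
  have h1 : ∫ t, t ^ j * laguerre α n t ∂(halfLineMeasure α) =
      ∑ p ∈ Finset.HasAntidiagonal.antidiagonal n, (-1) ^ p.1 / p.1.factorial *
        Ring.multichoose (α + 1 + p.1) p.2 * (ascPochhammer ℝ (j + p.1)).eval (α + 1) := by
    simp_rw [← integral_pow_halfLine hα, ← integral_const_mul]
    rw [← integral_finsetSum _ fun p _ => (integrable_pow_halfLine hα _).const_mul _]
    refine integral_congr_ae (Eventually.of_forall fun t => ?_)
    simp only [laguerre, Finset.mul_sum]
    refine Finset.sum_congr rfl fun p _ => ?_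
    rw [neg_pow t]
    ring
  set P : Polynomial ℝ := (ascPochhammer ℝ j).comp (Polynomial.X + Polynomial.C (α + 1)) with hP
  have hdeg : P.natDegree = j := by
    rw [hP, Polynomial.natDegree_comp, Polynomial.natDegree_X_add_C, mul_one,
      ascPochhammer_natDegree]
  have hlead : P.leadingCoeff = 1 :=
    (monic_ascPochhammer ℝ j).comp (Polynomial.monic_X_add_C _)
      (by rw [Polynomial.natDegree_X_add_C]; exact one_ne_zero)
  have h2 : ∑ p ∈ Finset.HasAntidiagonal.antidiagonal n, (-1) ^ p.1 / p.1.factorial *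
        Ring.multichoose (α + 1 + p.1) p.2 * (ascPochhammer ℝ (j + p.1)).eval (α + 1) =
      (ascPochhammer ℝ n).eval (α + 1) / n.factorial * (-1) ^ n *
        (fwdDiff 1)^[n] P.eval (0 : ℝ) := by
    rw [fwdDiff_iter_eq_sum_shift, Finset.Nat.sum_antidiagonal_eq_sum_range_succ_mk,
      Finset.mul_sum]
    refine Finset.sum_congr rfl fun k hk => ?_
    have hk : k ≤ n := Nat.lt_succ_iff.1 (Finset.mem_range.1 hk)
    -- The factor `(α + 1)_k` split off from the moment completes the numerator `(α + 1 + k)_(n -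
    -- k)` of the Laguerre coefficient to `(α + 1)_n`, which no longer depends on `k`.
    have h3 : (ascPochhammer ℝ n).eval (α + 1) =
        (ascPochhammer ℝ k).eval (α + 1) * (ascPochhammer ℝ (n - k)).eval (α + 1 + k) := by
      rw [← ascPochhammer_eval_add, Nat.add_sub_cancel' hk]
    have h4 : P.eval (0 + k • (1 : ℝ)) = (ascPochhammer ℝ j).eval (α + 1 + k) := by
      simp [hP, Polynomial.eval_comp, add_comm]
    have h5 : (-1 : ℝ) ^ n * (-1) ^ (n - k) = (-1) ^ k := by
      rw [← pow_add]
      have : n + (n - k) = k + 2 * (n - k) := by omega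
      rw [this, pow_add, pow_mul]
      simp
    have h6 := Nat.choose_mul_factorial_mul_factorial hk
    have h6' : (n.choose k : ℝ) * k.factorial * (n - k).factorial = n.factorial := by
      exact_mod_cast h6
    rw [h4, multichoose_eq_div, add_comm j k, ascPochhammer_eval_add, h3, zsmul_eq_mul]
    push_cast
    rw [← h5, ← h6']
    have := Nat.factorial_ne_zero k
    have := Nat.factorial_ne_zero (n - k)
    have : (n.choose k : ℝ) ≠ 0 := by
      exact_mod_cast (Nat.choose_pos hk).ne'
    field_simp
  rw [h1, h2]
  split_ifs with hjn
  · subst hjn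
    have h := P.fwdDiff_iter_degree_eq_factorial
    rw [hdeg, hlead] at h
    rw [h]
    simp only [Pi.smul_apply, smul_eq_mul, one_mul, Pi.natCast_apply]
    have : (j.factorial : ℝ) ≠ 0 := by positivity
    field_simp
  · rw [Polynomial.fwdDiff_iter_eq_zero_of_degree_lt (by omega)]
    simp

theorem integrable_laguerre_mul_laguerre (m n : ℕ) :
    Integrable (fun t => laguerre α m t * laguerre α n t) (halfLineMeasure α) := by
  simp only [laguerre.eq_1 α m, Finset.sum_mul]
  refine integrable_finsetSum _ fun p _ => ?_
  refine ((integrable_pow_mul_laguerre hα p.1 n).const_mul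
    ((-1) ^ p.1 / p.1.factorial * Ring.multichoose (α + 1 + p.1) p.2)).congr
    (Eventually.of_forall fun t => ?_)
  simp only
  rw [neg_pow t]
  ring

theorem integral_laguerre_mul_laguerre_of_le {m n : ℕ} (hmn : m ≤ n) :
    ∫ t, laguerre α m t * laguerre α n t ∂(halfLineMeasure α) =
      if m = n then Ring.multichoose (α + 1) n else 0 := by
  have h1 : ∫ t, laguerre α m t * laguerre α n t ∂(halfLineMeasure α) =
      ∑ p ∈ Finset.HasAntidiagonal.antidiagonal m, (-1) ^ p.1 / p.1.factorial *
        Ring.multichoose (α + 1 + p.1) p.2 *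
          ∫ t, t ^ p.1 * laguerre α n t ∂(halfLineMeasure α) := by
    simp_rw [← integral_const_mul]
    rw [← integral_finsetSum _ fun p _ => (integrable_pow_mul_laguerre hα _ _).const_mul _]
    refine integral_congr_ae (Eventually.of_forall fun t => ?_)
    simp only [laguerre.eq_1 α m, Finset.sum_mul]
    refine Finset.sum_congr rfl fun p _ => ?_
    rw [neg_pow t]
    ring
  have hle : ∀ p ∈ Finset.HasAntidiagonal.antidiagonal m, p.1 ≤ n := fun p hp =>
    (Finset.HasAntidiagonal.antidiagonal.fst_le hp).trans hmn
  rw [h1, Finset.sum_congr rfl fun p hp => by rw [integral_pow_mul_laguerre hα (hle p hp)]]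
  split_ifs with h
  · subst h
    -- Only the leading term `(-t)^m / m!` of the first factor has degree high enough to survive.
    rw [Finset.sum_eq_single (m, 0)]
    · simp only [if_true, Ring.multichoose_zero_right, multichoose_eq_div (α + 1)]
      have : ((-1 : ℝ) ^ m) * (-1) ^ m = 1 := by rw [← mul_pow]; simp
      field_simp
      linear_combination (Polynomial.eval (α + 1) (ascPochhammer ℝ m)) * this
    · rintro ⟨k, l⟩ hkl hne
      rw [Finset.HasAntidiagonal.mem_antidiagonal] at hkl
      rw [if_neg, mul_zero]
      rintro rfl
      exact hne (by ext <;> simp at hkl ⊢; exact hkl)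
    · intro h
      simp at h
  · refine Finset.sum_eq_zero fun p hp => ?_
    rw [if_neg, mul_zero]
    have := Finset.HasAntidiagonal.antidiagonal.fst_le hp
    omega

theorem integral_laguerre_mul_laguerre (m n : ℕ) :
    ∫ t, laguerre α m t * laguerre α n t ∂(halfLineMeasure α) =
      if m = n then Ring.multichoose (α + 1) n else 0 := by
  rcases le_total m n with h | h
  · exact integral_laguerre_mul_laguerre_of_le hα h
  · simp_rw [mul_comm (laguerre α m _)]
    rw [integral_laguerre_mul_laguerre_of_le hα h]
    rcases eq_or_ne m n with rfl | hne
    · simp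
    · rw [if_neg hne, if_neg hne.symm]

omit hα in
theorem continuous_laguerre (n : ℕ) : Continuous (laguerre α n) := by
  unfold laguerre
  fun_prop

/-- The normalized Laguerre polynomials, as quaternion valued functions. -/
def laguerreUnit (α : ℝ) (n : ℕ) (t : ℝ) : ℍ :=
  ((laguerre α n t / √(Ring.multichoose (α + 1) n) : ℝ) : ℍ)

theorem laguerreUnit_orthonormal : QOrthonormal (laguerreUnit α) (halfLineMeasure α) where
  memLp n := by
    have hc : Continuous (laguerreUnit α n) :=
      Quaternion.continuous_coe.comp ((continuous_laguerre n).div_const _)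
    rw [memLp_two_iff_integrable_sq_norm hc.aestronglyMeasurable]
    refine ((integrable_laguerre_mul_laguerre hα n n).div_const
      (√(Ring.multichoose (α + 1) n) ^ 2)).congr (Eventually.of_forall fun t => ?_)
    simp only [laguerreUnit, Quaternion.norm_coe, Real.norm_eq_abs, sq_abs, div_pow]
    ring
  integral_star_mul m n := by
    have h : ∀ t, star (laguerreUnit α m t) * laguerreUnit α n t =
        ((laguerre α m t * laguerre α n t /
          (√(Ring.multichoose (α + 1) m) * √(Ring.multichoose (α + 1) n)) : ℝ) : ℍ) := by
      intro t
      simp only [laguerreUnit, Quaternion.star_coe, ← Quaternion.coe_mul]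
      congr 1
      ring
    simp_rw [h]
    have h2 : ∀ f : ℝ → ℝ, ∫ t, ((f t : ℝ) : ℍ) ∂(halfLineMeasure α) =
        ((∫ t, f t ∂(halfLineMeasure α) : ℝ) : ℍ) := fun f => by
      have hs : ∀ r : ℝ, (r : ℍ) = r • (1 : ℍ) := fun r => by
        rw [← Quaternion.coe_mul_eq_smul, mul_one]
      simp_rw [hs]
      exact integral_smul_const _ _
    rw [h2, integral_div, integral_laguerre_mul_laguerre hα]
    split_ifs with hmn
    · subst hmn
      have := multichoose_pos (a := α + 1) (by positivity) m
      rw [Real.mul_self_sqrt this.le, div_self this.ne', Quaternion.coe_one]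
    · simp

end Moments

/-! ### Integrals of monomials over the weighted disc. -/

section Disc

/-- The density of the weighted measure of the disc. -/
def discDensity (R α : ℝ) (z : ℂ) : ℝ := α / (Real.pi * R ^ 2) * (1 - ‖z‖ ^ 2 / R ^ 2) ^ (α - 1)

theorem measurable_discDensity (R α : ℝ) : Measurable (discDensity R α) := by
  unfold discDensity
  fun_prop

variable {R α : ℝ} (hR : 0 < R) (hα : 0 < α)
include hR hα

theorem discDensity_nonneg {z : ℂ} (hz : z ∈ ball (0 : ℂ) R) : 0 ≤ discDensity R α z := by
  rw [mem_ball_zero_iff] at hz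
  have : ‖z‖ ^ 2 / R ^ 2 ≤ 1 := by
    rw [div_le_one (by positivity)]
    gcongr
  exact mul_nonneg (by positivity) (Real.rpow_nonneg (by linarith) _)

omit hR hα in
theorem discMeasure_restrict {r : ℝ} (hr : r ≤ R) : (discMeasure R α).restrict (ball 0 r) =
    (volume.restrict (ball (0 : ℂ) r)).withDensity fun z => ENNReal.ofReal (discDensity R α z) := by
  rw [discMeasure, restrict_withDensity measurableSet_ball, Measure.restrict_restrict
    measurableSet_ball, Set.inter_eq_left.2 (ball_subset_ball hr)]
  rfl

omit hR hα in
theorem discMeasure_restrict_self : (discMeasure R α).restrict (ball 0 R) = discMeasure R α := by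
  rw [discMeasure_restrict le_rfl]
  rfl

omit hR hα in
theorem ae_mem_ball_discMeasure : ∀ᵐ z ∂(discMeasure R α), z ∈ ball (0 : ℂ) R := by
  rw [← discMeasure_restrict_self]
  exact ae_restrict_mem measurableSet_ball

theorem setIntegral_disc {E : Type*} [NormedAddCommGroup E] [NormedSpace ℝ E] (f : ℂ → E) {r : ℝ}
    (hr : r ≤ R) : ∫ z in ball 0 r, f z ∂(discMeasure R α) =
      ∫ z in ball 0 r, discDensity R α z • f z := by
  rw [discMeasure_restrict hr, integral_withDensity_eq_integral_toReal_smul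
    (measurable_discDensity R α).ennreal_ofReal (Eventually.of_forall fun _ =>
      ENNReal.ofReal_lt_top)]
  refine setIntegral_congr_fun measurableSet_ball fun z hz => ?_
  simp only [ENNReal.toReal_ofReal (discDensity_nonneg hR hα (ball_subset_ball hr hz))]

theorem integrableOn_disc_iff {E : Type*} [NormedAddCommGroup E] [NormedSpace ℝ E] (f : ℂ → E)
    {r : ℝ} (hr : r ≤ R) : IntegrableOn f (ball 0 r) (discMeasure R α) ↔
      IntegrableOn (fun z => discDensity R α z • f z) (ball 0 r) := by
  rw [IntegrableOn, discMeasure_restrict hr, integrable_withDensity_iff_integrable_smul'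
    (measurable_discDensity R α).ennreal_ofReal (Eventually.of_forall fun _ =>
      ENNReal.ofReal_lt_top)]
  refine integrableOn_congr_fun (fun z hz => ?_) measurableSet_ball
  simp only [ENNReal.toReal_ofReal (discDensity_nonneg hR hα (ball_subset_ball hr hz))]

omit hR in
-- This is the Beta value `B(n + 1, α) = n! Γ(α) / Γ(n + 1 + α)`.
theorem integral_pow_mul_one_sub_rpow (n : ℕ) :
    ∫ s in Set.Ioo (0 : ℝ) 1, s ^ n * (1 - s) ^ (α - 1) =
      (α * Ring.multichoose (α + 1) n)⁻¹ := by
  have h1 : ProbabilityTheory.beta (n + 1) α = (α * Ring.multichoose (α + 1) n)⁻¹ := by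
    have h2 : (n + 1 + α : ℝ) = (α + 1) + n := by ring
    rw [ProbabilityTheory.beta, h2, Gamma_add_nat (by positivity), Real.Gamma_nat_eq_factorial,
      Real.Gamma_add_one hα.ne', multichoose_eq_div]
    have h3 := (Real.Gamma_pos_of_pos hα).ne'
    have h4 := (ascPochhammer_pos n (α + 1) (by positivity)).ne'
    field_simp
  rw [← h1, ProbabilityTheory.beta_eq_betaIntegralReal _ _ (by positivity) hα,
    Complex.betaIntegral, intervalIntegral.integral_of_le (by norm_num),
    ← integral_Ioc_eq_integral_Ioo, ← RCLike.re_to_complex, ← integral_re]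
  · refine setIntegral_congr_fun measurableSet_Ioc fun x ⟨hx1, hx2⟩ => ?_
    have h2 : (((n + 1 : ℝ) : ℂ) - 1) = ((n : ℝ) : ℂ) := by push_cast; ring
    have h3 : (1 - (x : ℂ)) ^ ((α : ℂ) - 1) = (((1 - x) ^ (α - 1) : ℝ) : ℂ) := by
      rw [Complex.ofReal_cpow (by linarith)]
      push_cast
      rfl
    rw [h2, h3, ← Complex.ofReal_cpow hx1.le, Real.rpow_natCast, ← Complex.ofReal_mul]
    rfl
  · have h := Complex.betaIntegral_convergent (u := ((n + 1 : ℝ) : ℂ)) (v := α)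
      (by simp; positivity) (by simpa)
    rwa [intervalIntegrable_iff_integrableOn_Ioc_of_le (by norm_num)] at h

/-- Polar coordinates and the substitution `s = ‖z‖² / R²` reduce this to the Beta integral. -/
theorem integral_norm_pow_disc (n : ℕ) :
    ∫ z, ‖z‖ ^ (2 * n) ∂(discMeasure R α) = R ^ (2 * n) / Ring.multichoose (α + 1) n := by
  rw [← discMeasure_restrict_self, setIntegral_disc hR hα _ le_rfl]
  -- The indicator encodes `‖z‖ < R`, so that the changes of variable can be done on the whole
  -- half-line.
  let G : ℝ → ℝ := (Set.Iio 1).indicator fun s => s ^ n * (1 - s) ^ (α - 1)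
  have h1 : ∀ z : ℂ, (ball (0 : ℂ) R).indicator
      (fun z => discDensity R α z • ‖z‖ ^ (2 * n)) z =
      (fun y : ℝ => α / (Real.pi * R ^ 2) * R ^ (2 * n) * G (y ^ (2 : ℝ) * (R ^ 2)⁻¹)) ‖z‖ := by
    intro z
    have hlt : ‖z‖ ^ 2 * (R ^ 2)⁻¹ < 1 ↔ z ∈ ball (0 : ℂ) R := by
      rw [mem_ball_zero_iff, ← div_eq_mul_inv, div_lt_one (by positivity),
        sq_lt_sq₀ (norm_nonneg _) hR.le]
    simp only [Real.rpow_two]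
    by_cases hz : z ∈ ball (0 : ℂ) R
    · simp only [G]
      rw [Set.indicator_of_mem hz, Set.indicator_of_mem (Set.mem_Iio.2 (hlt.2 hz)), discDensity, smul_eq_mul, mul_pow, inv_pow, ← pow_mul, ← pow_mul, div_eq_mul_inv (_ ^ 2)]
      field_simp
    · simp only [G]
      rw [Set.indicator_of_notMem hz, Set.indicator_of_notMem (fun h => hz (hlt.1 (Set.mem_Iio.1 h))),
        mul_zero]
  rw [← integral_indicator measurableSet_ball]
  simp_rw [h1]
  rw [integral_fun_norm_addHaar volume
    (fun y : ℝ => α / (Real.pi * R ^ 2) * R ^ (2 * n) * G (y ^ (2 : ℝ) * (R ^ 2)⁻¹))]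
  have h2 : ∫ y in Set.Ioi (0 : ℝ), y ^ (Module.finrank ℝ ℂ - 1) •
      (α / (Real.pi * R ^ 2) * R ^ (2 * n) * G (y ^ (2 : ℝ) * (R ^ 2)⁻¹)) =
      α / (Real.pi * R ^ 2) * R ^ (2 * n) * 2⁻¹ *
        ∫ y in Set.Ioi (0 : ℝ), (|(2 : ℝ)| * y ^ ((2 : ℝ) - 1)) • G (y ^ (2 : ℝ) * (R ^ 2)⁻¹) := by
    rw [← integral_const_mul]
    refine setIntegral_congr_fun measurableSet_Ioi fun y hy => ?_
    have : (2 : ℝ) - 1 = 1 := by norm_num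
    simp only [Complex.finrank_real_complex, smul_eq_mul, this, Real.rpow_one, abs_two]
    ring
  have h3 := integral_comp_rpow_Ioi (fun s => G (s * (R ^ 2)⁻¹)) (two_ne_zero (α := ℝ))
  have h4 := integral_comp_mul_right_Ioi G 0 (b := (R ^ 2)⁻¹) (by positivity)
  have h5 : ∫ s in Set.Ioi (0 : ℝ), G s = (α * Ring.multichoose (α + 1) n)⁻¹ := by
    rw [← integral_pow_mul_one_sub_rpow hα, setIntegral_indicator measurableSet_Iio,
      Set.Ioi_inter_Iio]
  have hv : volume.real (ball (0 : ℂ) 1) = Real.pi := by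
    simp [Measure.real, Complex.volume_ball]
  rw [h2, h3, h4, zero_mul, h5, hv, Complex.finrank_real_complex]
  have := (multichoose_pos (a := α + 1) (by positivity) n).ne'
  simp only [inv_inv, smul_eq_mul, nsmul_eq_mul]
  push_cast
  field_simp

theorem isProbabilityMeasure_disc : IsProbabilityMeasure (discMeasure R α) := by
  have h := integral_norm_pow_disc hR hα 0
  simp only [mul_zero, pow_zero, Ring.multichoose_zero_right, div_one, integral_const,
    smul_eq_mul, mul_one] at h
  exact ⟨(ENNReal.toReal_eq_one_iff _).1 h⟩

theorem integrable_disc_of_continuous {E : Type*} [NormedAddCommGroup E] [NormedSpace ℝ E]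
    {f : ℂ → E} (hf : Continuous f) : Integrable f (discMeasure R α) := by
  have := isProbabilityMeasure_disc hR hα
  have h1 : IntegrableOn f (closedBall 0 R) (discMeasure R α) :=
    hf.continuousOn.integrableOn_compact (isCompact_closedBall 0 R)
  have h2 := h1.mono_set ball_subset_closedBall
  rwa [IntegrableOn, discMeasure_restrict_self] at h2

/-- A rotation by the angle `π / (n - m)` preserves the disc and the weight but changes the sign of
the integrand. Having this on every concentric disc is what later allows integration term by term
away from the boundary. -/
theorem setIntegral_conj_pow_mul_pow_disc {m n : ℕ} (hmn : m ≠ n) {r : ℝ} (hr : r ≤ R) :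
    ∫ z in ball 0 r, star z ^ m * z ^ n ∂(discMeasure R α) = 0 := by
  rw [setIntegral_disc hR hα _ hr, ← integral_indicator measurableSet_ball]
  set H : ℂ → ℂ := (ball (0 : ℂ) r).indicator fun z => discDensity R α z • (star z ^ m * z ^ n)
  set θ : ℝ := Real.pi / ((n : ℝ) - m) with hθ
  have hne : (n : ℝ) - m ≠ 0 := sub_ne_zero.2 (by exact_mod_cast hmn.symm)
  set e : Circle := Circle.exp θ with he
  have he1 : star (e : ℂ) ^ m * (e : ℂ) ^ n = -1 := by
    rw [he, Circle.coe_exp, Complex.star_def, ← Complex.exp_conj, ← Complex.exp_nat_mul,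
      ← Complex.exp_nat_mul, ← Complex.exp_add, ← Complex.exp_pi_mul_I]
    congr 1
    have hne' : (n : ℂ) - m ≠ 0 := by exact_mod_cast hne
    simp only [map_mul, Complex.conj_ofReal, Complex.conj_I, hθ]
    push_cast
    field_simp
    ring
  have h1 : ∀ z, H (rotation e z) = -H z := by
    intro z
    have hmem : rotation e z ∈ ball (0 : ℂ) r ↔ z ∈ ball (0 : ℂ) r := by
      rw [mem_ball_zero_iff, mem_ball_zero_iff, LinearIsometryEquiv.norm_map]
    have hd : discDensity R α (rotation e z) = discDensity R α z := by
      rw [discDensity, discDensity, LinearIsometryEquiv.norm_map]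
    simp only [H]
    by_cases hz : z ∈ ball (0 : ℂ) r
    · rw [Set.indicator_of_mem hz, Set.indicator_of_mem (hmem.2 hz), hd,
        ← smul_neg, rotation_apply, star_mul', mul_pow, mul_pow]
      congr 1
      linear_combination (star z ^ m * z ^ n) * he1
    · rw [Set.indicator_of_notMem hz, Set.indicator_of_notMem (fun h => hz (hmem.1 h)), neg_zero]
  have h2 := (rotation e).measurePreserving.integral_comp
    (rotation e).toHomeomorph.measurableEmbedding H
  simp_rw [h1, integral_neg] at h2
  have h3 : (2 : ℂ) * ∫ z, H z = 0 := by linear_combination -h2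
  simpa using h3

end Disc

/-! ### The normalized monomials are orthonormal. -/

section Monomials

variable {R α : ℝ} {I : ℍ}

theorem integral_toSlice (I : imagUnits) {μ : Measure ℂ} {F : ℂ → ℂ} (hF : Integrable F μ) :
    ∫ z, toSlice I.1 (F z) ∂μ = toSlice I.1 (∫ z, F z ∂μ) := by
  have h := (sliceMulCLM I 1).integral_comp_comm hF
  simpa only [sliceMulCLM_apply, mul_one] using h

/-- The normalized monomials on the disc, as functions with values in a slice. -/
def monomialUnit (R α : ℝ) (I : ℍ) (n : ℕ) (z : ℂ) : ℍ :=
  toSlice I ((√(Ring.multichoose (α + 1) n) : ℂ) * (z / R) ^ n)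

theorem continuous_monomialUnit (n : ℕ) : Continuous (monomialUnit R α I n) :=
  (continuous_toSlice I).comp (by fun_prop)

variable (hR : 0 < R) (hα : 0 < α) (hI : I ∈ imagUnits)
include hR hα hI

omit hR hα in
theorem star_monomialUnit_mul (m n : ℕ) (z : ℂ) :
    star (monomialUnit R α I m z) * monomialUnit R α I n z =
      toSlice I ((√(Ring.multichoose (α + 1) m) * √(Ring.multichoose (α + 1) n) / R ^ (m + n) : ℝ) *
        (star z ^ m * z ^ n)) := by
  rw [monomialUnit, monomialUnit, toSlice_star hI, ← toSlice_mul hI]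
  congr 1
  simp only [star_mul', star_pow, star_div₀, Complex.star_def, Complex.conj_ofReal]
  push_cast
  rw [div_pow, div_pow, pow_add]
  ring

theorem setIntegral_star_monomialUnit_mul {m n : ℕ} (hmn : m ≠ n) {r : ℝ} (hr : r ≤ R) :
    ∫ z in ball 0 r, star (monomialUnit R α I m z) * monomialUnit R α I n z ∂(discMeasure R α) =
      0 := by
  simp_rw [star_monomialUnit_mul hI]
  rw [integral_toSlice ⟨I, hI⟩, integral_const_mul, setIntegral_conj_pow_mul_pow_disc hR hα hmn hr,
    mul_zero]
  · simp [toSlice]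
  · exact (integrable_disc_of_continuous hR hα (by fun_prop)).integrableOn

theorem monomialUnit_orthonormal : QOrthonormal (monomialUnit R α I) (discMeasure R α) where
  memLp n := by
    rw [memLp_two_iff_integrable_sq_norm (continuous_monomialUnit n).aestronglyMeasurable]
    exact integrable_disc_of_continuous hR hα ((continuous_monomialUnit n).norm.pow 2)
  integral_star_mul m n := by
    split_ifs with hmn
    · subst hmn
      have h : ∀ z, star (monomialUnit R α I m z) * monomialUnit R α I m z =
          (Ring.multichoose (α + 1) m / R ^ (2 * m) * ‖z‖ ^ (2 * m)) • (1 : ℍ) := by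
        intro z
        have hc := multichoose_pos (a := α + 1) (by positivity) m
        rw [star_monomialUnit_mul hI, Real.mul_self_sqrt hc.le, ← mul_pow, Complex.star_def,
          Complex.conj_mul', ← pow_mul, ← Complex.ofReal_pow, ← Complex.ofReal_mul,
          toSlice_ofReal, ← two_mul, ← Quaternion.coe_mul_eq_smul, mul_one]
      simp_rw [h]
      rw [integral_smul_const, integral_const_mul, integral_norm_pow_disc hR hα]
      have hc := (multichoose_pos (a := α + 1) (by positivity) m).ne'
      have : Ring.multichoose (α + 1) m / R ^ (2 * m) *
          (R ^ (2 * m) / Ring.multichoose (α + 1) m) = 1 := by field_simp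
      rw [this, one_smul]
    · have := setIntegral_star_monomialUnit_mul hR hα hI hmn le_rfl
      rwa [discMeasure_restrict_self] at this

end Monomials

/-! ### A uniform bound on pairings, and quaternionic constants in integrals. -/

section Bounds

variable {X : Type*} [MeasurableSpace X] {μ : Measure X} {u : ℕ → X → ℍ}

theorem QOrthonormal.integral_norm_sq (hu : QOrthonormal u μ) (n : ℕ) :
    ∫ x, ‖u n x‖ ^ 2 ∂μ = 1 := by
  have h := hu.integral_star_mul n n
  have h1 : ∀ x, star (u n x) * u n x = (‖u n x‖ ^ 2) • (1 : ℍ) := fun x => by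
    rw [Quaternion.star_mul_self, Quaternion.normSq_eq_norm_mul_self, ← sq,
      ← Quaternion.coe_mul_eq_smul, mul_one]
  simp_rw [h1] at h
  rw [integral_smul_const, if_pos trivial] at h
  simpa using congrArg (fun q : ℍ => q.re) h

theorem QOrthonormal.integral_norm_mul_norm_le (hu : QOrthonormal u μ) {φ : X → ℍ}
    (hφ : MemLp φ 2 μ) (n : ℕ) :
    ∫ x, ‖u n x‖ * ‖φ x‖ ∂μ ≤ 1 + ∫ x, ‖φ x‖ ^ 2 ∂μ := by
  have h1 := (memLp_two_iff_integrable_sq_norm (hu.memLp n).1).1 (hu.memLp n)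
  have h2 := (memLp_two_iff_integrable_sq_norm hφ.1).1 hφ
  rw [← hu.integral_norm_sq n, ← integral_add h1 h2]
  refine integral_mono (integrable_norm_mul_norm (hu.memLp n) hφ) (h1.add h2) fun x => ?_
  simp only
  nlinarith [sq_nonneg (‖u n x‖ - ‖φ x‖), sq_nonneg (‖u n x‖), sq_nonneg ‖φ x‖]

/-- Integrability is not needed, because multiplication by a nonzero quaternion is a linear
isomorphism. -/
theorem integral_quaternion_mul_left (c : ℍ) (f : X → ℍ) :
    ∫ x, c * f x ∂μ = c * ∫ x, f x ∂μ := by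
  rcases eq_or_ne c 0 with rfl | hc
  · simp
  · let L : ℍ ≃L[ℝ] ℍ := ContinuousLinearEquiv.equivOfInverse (ContinuousLinearMap.mul ℝ ℍ c)
      (ContinuousLinearMap.mul ℝ ℍ c⁻¹) (fun x => by simp [inv_mul_cancel_left₀ hc])
      (fun x => by simp [mul_inv_cancel_left₀ hc])
    exact L.integral_comp_comm f

theorem integral_quaternion_mul_right (c : ℍ) (f : X → ℍ) :
    ∫ x, f x * c ∂μ = (∫ x, f x ∂μ) * c := by
  rcases eq_or_ne c 0 with rfl | hc
  · simp
  · let L : ℍ ≃L[ℝ] ℍ := ContinuousLinearEquiv.equivOfInverse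
      ((ContinuousLinearMap.mul ℝ ℍ).flip c)
      ((ContinuousLinearMap.mul ℝ ℍ).flip c⁻¹) (fun x => by simp [mul_inv_cancel_right₀ hc])
      (fun x => by simp [inv_mul_cancel_right₀ hc])
    exact L.integral_comp_comm f

end Bounds

/-! ### The kernel on a slice and the power series of the transform. -/

section Kernel

variable {R α : ℝ}

theorem qpow_mul_exp_eq (hR : 0 < R) {I : ℍ} (hI : I ∈ imagUnits) (t : ℝ) {z : ℂ} (hz : ‖z‖ < R) :
    qpow (1 - toSlice I z / (R : ℍ)) (-α - 1) *
      NormedSpace.exp ((t : ℍ) * toSlice I z / (toSlice I z - (R : ℍ))) =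
        toSlice I (laguerreKernel α t (z / R)) := by
  have h1 : 1 - toSlice I z / (R : ℍ) = toSlice I (1 - z / R) := by
    rw [toSlice_sub, toSlice_one hI, toSlice_div hI, toSlice_ofReal]
  have h2 : (t : ℍ) * toSlice I z / (toSlice I z - (R : ℍ)) =
      toSlice I (t * (z / R) / (z / R - 1)) := by
    have hR' : (R : ℂ) ≠ 0 := by exact_mod_cast hR.ne'
    have h3 : (t : ℂ) * (z / R) / (z / R - 1) = t * z / (z - R) := by
      rw [div_sub_one hR']
      field_simp
    rw [h3, toSlice_div hI, toSlice_mul hI, toSlice_sub, toSlice_ofReal, toSlice_ofReal]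
  have h3 : 0 < (1 - z / R).re := by
    have h4 : (z / R).re ≤ ‖z / R‖ := Complex.re_le_norm _
    have h5 : ‖z / R‖ < 1 := by
      rw [norm_div, Complex.norm_real, Real.norm_of_nonneg hR.le, div_lt_one hR]
      exact hz
    rw [Complex.sub_re, Complex.one_re]
    linarith
  rw [h1, h2, qpow_toSlice hI _ h3, ← toSlice_exp hI, ← toSlice_mul hI, laguerreKernel]
  push_cast
  rfl

theorem transform_eq_integral (hR : 0 < R) (φ : Lp ℍ 2 (halfLineMeasure α)) {I : ℍ}
    (hI : I ∈ imagUnits) {z : ℂ} (hz : toSlice I z ∈ ball (0 : ℍ) R) :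
    transform R α φ ⟨toSlice I z, hz⟩ =
      ∫ t, toSlice I (laguerreKernel α t (z / R)) * φ t ∂(halfLineMeasure α) := by
  rw [transform, ← integral_quaternion_mul_left]
  rw [mem_ball_zero_iff, norm_toSlice hI] at hz
  simp_rw [← mul_assoc, qpow_mul_exp_eq hR hI _ hz]

theorem summable_sqrt_multichoose_mul_pow (hα : 0 < α) {ρ : ℝ} (h0 : 0 ≤ ρ) (h1 : ρ < 1) :
    Summable fun n => √(Ring.multichoose (α + 1) n) * ρ ^ n := by
  refine Summable.of_nonneg_of_le (fun n => by positivity) (fun n => ?_)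
    ((hasSum_multichoose_mul_pow_real (α + 1) h0 h1).summable.add
      (summable_geometric_of_lt_one h0 h1))
  have hc := (multichoose_pos (a := α + 1) (by positivity) n).le
  have : √(Ring.multichoose (α + 1) n) ≤ Ring.multichoose (α + 1) n + 1 := by
    rw [Real.sqrt_le_left (by positivity)]
    nlinarith
  calc _ ≤ (Ring.multichoose (α + 1) n + 1) * ρ ^ n := by gcongr
    _ = _ := by ring

theorem sqrt_multichoose_smul_laguerreUnit (hα : 0 < α) (n : ℕ) (t : ℝ) :
    √(Ring.multichoose (α + 1) n) • laguerreUnit α n t = (laguerre α n t : ℍ) := by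
  have hc := multichoose_pos (a := α + 1) (by positivity) n
  have : √(Ring.multichoose (α + 1) n) ≠ 0 := (Real.sqrt_pos.2 hc).ne'
  rw [laguerreUnit, ← Quaternion.coe_mul_eq_smul, ← Quaternion.coe_mul]
  congr 1
  field_simp

theorem star_laguerreUnit (n : ℕ) (t : ℝ) : star (laguerreUnit α n t) = laguerreUnit α n t := by
  rw [laguerreUnit, Quaternion.star_coe]

theorem hasSum_toSlice {I : ℍ} (hI : I ∈ imagUnits) {u : ℕ → ℂ} {z : ℂ} (h : HasSum u z) :
    HasSum (fun n => toSlice I (u n)) (toSlice I z) := by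
  have := (sliceMulCLM ⟨I, hI⟩ 1).hasSum h
  simpa only [sliceMulCLM_apply, mul_one] using this

/-- Integrate the generating function against `φ` term by term. The norms of the terms are summable
because the pairings of `φ` with the `laguerreUnit`s are bounded uniformly in `n`. -/
theorem hasSum_transform (hR : 0 < R) (hα : 0 < α) (φ : Lp ℍ 2 (halfLineMeasure α))
    (q : ball (0 : ℍ) R) :
    HasSum (fun n => (q : ℍ) ^ n * ((√(Ring.multichoose (α + 1) n) / R ^ n) •
      ∫ t, star (laguerreUnit α n t) * φ t ∂(halfLineMeasure α))) (transform R α φ q) := by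
  obtain ⟨q, hq⟩ := q
  obtain ⟨I, hI, z, rfl⟩ := exists_eq_toSlice q
  have hz := hq
  rw [mem_ball_zero_iff, norm_toSlice hI] at hz
  have hz1 : ‖z / R‖ < 1 := by
    rw [norm_div, Complex.norm_real, Real.norm_of_nonneg hR.le, div_lt_one hR]
    exact hz
  have hu := laguerreUnit_orthonormal hα
  rw [transform_eq_integral hR φ hI]
  set F : ℕ → ℝ → ℍ := fun n t => (√(Ring.multichoose (α + 1) n) •
    toSlice I ((z / R) ^ n)) * (star (laguerreUnit α n t) * φ t) with hF
  have hint : ∀ n, Integrable (F n) (halfLineMeasure α) := fun n =>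
    (integrable_star_mul (hu.memLp n) (Lp.memLp φ)).const_mul _
  have hnorm : ∀ n, ∫ t, ‖F n t‖ ∂(halfLineMeasure α) =
      √(Ring.multichoose (α + 1) n) * ‖z / R‖ ^ n *
        ∫ t, ‖laguerreUnit α n t‖ * ‖φ t‖ ∂(halfLineMeasure α) := by
    intro n
    rw [← integral_const_mul]
    refine integral_congr_ae (Eventually.of_forall fun t => ?_)
    simp only [hF, norm_mul, norm_smul, norm_toSlice hI, Quaternion.norm_star, norm_pow,
      Real.norm_of_nonneg (Real.sqrt_nonneg _)]
  have hsum : Summable fun n => ∫ t, ‖F n t‖ ∂(halfLineMeasure α) := by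
    simp_rw [hnorm]
    refine Summable.of_nonneg_of_le (fun n => ?_) (fun n => ?_)
      ((summable_sqrt_multichoose_mul_pow hα (norm_nonneg _) hz1).mul_right
        (1 + ∫ t, ‖φ t‖ ^ 2 ∂(halfLineMeasure α)))
    · exact mul_nonneg (by positivity) (integral_nonneg fun t => by positivity)
    · exact mul_le_mul_of_nonneg_left (hu.integral_norm_mul_norm_le (Lp.memLp φ) n)
        (by positivity)
  have h := hasSum_integral_of_summable_integral_norm hint hsum
  refine hasSum_of_eq h (fun n => ?_) ?_
  · rw [integral_quaternion_mul_left, toSlice_pow hI, toSlice_div hI, toSlice_ofReal]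
    have : toSlice I z / (R : ℍ) = R⁻¹ • toSlice I z := by
      rw [div_eq_mul_inv, ← Quaternion.coe_inv, Quaternion.mul_coe_eq_smul]
    rw [this, smul_pow, smul_smul, mul_smul_comm, smul_mul_assoc, div_eq_mul_inv, inv_pow]
  · refine integral_congr_ae (Eventually.of_forall fun t => ?_)
    simp only
    have h1 := (hasSum_toSlice hI (hasSum_laguerre hα t hz1)).mul_right (φ t)
    rw [← h1.tsum_eq]
    refine tsum_congr fun n => ?_
    simp only [hF]
    rw [toSlice_mul hI, toSlice_ofReal, ← sqrt_multichoose_smul_laguerreUnit hα,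
      star_laguerreUnit, mul_smul_comm, ← mul_assoc, smul_mul_assoc, smul_mul_assoc,
      smul_mul_assoc]

theorem isSliceRegular_transform (hR : 0 < R) (hα : 0 < α) (φ : Lp ℍ 2 (halfLineMeasure α)) :
    IsSliceRegular (transform R α φ) :=
  isSliceRegular_of_hasSum hR (hasSum_transform hR hα φ)

end Kernel

/-! ### Completeness of the Laguerre polynomials. -/

section Completeness

/-- The positive and negative parts of `g` are densities of two finite measures with the same
characteristic function, so they agree almost everywhere; as one of them vanishes at each point, so
does the other. -/
theorem ae_eq_zero_of_integral_cos_sin {μ : Measure ℝ} {g : ℝ → ℝ} (hg : Integrable g μ)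
    (hcos : ∀ θ : ℝ, ∫ t, Real.cos (θ * t) * g t ∂μ = 0)
    (hsin : ∀ θ : ℝ, ∫ t, Real.sin (θ * t) * g t ∂μ = 0) : g =ᵐ[μ] 0 := by
  have hm : AEMeasurable g μ := hg.aemeasurable
  have hf1 : IsFiniteMeasure (μ.withDensity fun t => ENNReal.ofReal (g t)) :=
    isFiniteMeasure_withDensity_ofReal hg.2
  have hf2 : IsFiniteMeasure (μ.withDensity fun t => ENNReal.ofReal (-g t)) :=
    isFiniteMeasure_withDensity_ofReal hg.neg.2
  have hm' : AEMeasurable (fun t => -g t) μ := hm.neg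
  have hexp : ∀ θ : ℝ, ∫ t, g t • Complex.exp (θ * t * Complex.I) ∂μ = 0 := by
    intro θ
    have h1 : Integrable (fun t => Real.cos (θ * t) * g t) μ :=
      hg.bdd_mul (c := 1) (by fun_prop) (Eventually.of_forall fun t => Real.abs_cos_le_one _)
    have h2 : Integrable (fun t => Real.sin (θ * t) * g t) μ :=
      hg.bdd_mul (c := 1) (by fun_prop) (Eventually.of_forall fun t => Real.abs_sin_le_one _)
    have h3 : ∀ t : ℝ, g t • Complex.exp (θ * t * Complex.I) =
        (Real.cos (θ * t) * g t : ℝ) + (Real.sin (θ * t) * g t : ℝ) * Complex.I := by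
      intro t
      rw [Complex.exp_mul_I, Complex.real_smul]
      push_cast
      ring
    simp_rw [h3]
    rw [integral_add h1.ofReal (h2.ofReal.mul_const _), integral_mul_const]
    have h4 := integral_ofReal (𝕜 := ℂ) (μ := μ) (f := fun t => Real.cos (θ * t) * g t)
    have h5 := integral_ofReal (𝕜 := ℂ) (μ := μ) (f := fun t => Real.sin (θ * t) * g t)
    simp only [Complex.coe_algebraMap] at h4 h5
    erw [h4, h5]
    rw [hcos, hsin]
    simp
  have heq : μ.withDensity (fun t => ENNReal.ofReal (g t)) =
      μ.withDensity fun t => ENNReal.ofReal (-g t) := by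
    refine Measure.ext_of_charFun (funext fun θ => ?_)
    rw [charFun_apply_real, charFun_apply_real,
      integral_withDensity_eq_integral_toReal_smul₀ hm.ennreal_ofReal
        (Eventually.of_forall fun _ => ENNReal.ofReal_lt_top),
      integral_withDensity_eq_integral_toReal_smul₀ hm'.ennreal_ofReal
        (Eventually.of_forall fun _ => ENNReal.ofReal_lt_top), ← sub_eq_zero]
    have hb : ∀ h : ℝ → ℝ, Integrable h μ →
        Integrable (fun t => h t • Complex.exp (θ * t * Complex.I)) μ := fun h hh =>
      hh.smul_bdd 1 (f := fun t : ℝ => Complex.exp (θ * t * Complex.I)) (by fun_prop)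
        (Eventually.of_forall fun t => by
          rw [← Complex.ofReal_mul, Complex.norm_exp_ofReal_mul_I])
    have hp : Integrable (fun t => (ENNReal.ofReal (g t)).toReal) μ := by
      simpa only [ENNReal.toReal_ofReal'] using hg.pos_part
    have hn : Integrable (fun t => (ENNReal.ofReal (-g t)).toReal) μ := by
      simpa only [ENNReal.toReal_ofReal'] using hg.neg_part
    rw [← integral_sub (hb _ hp) (hb _ hn), ← hexp θ]
    refine integral_congr_ae (Eventually.of_forall fun t => ?_)
    simp only
    rw [← sub_smul, ENNReal.toReal_ofReal', ENNReal.toReal_ofReal']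
    congr 1
    rcases le_total 0 (g t) with h | h
    · rw [max_eq_left h, max_eq_right (by linarith), sub_zero]
    · rw [max_eq_right h, max_eq_left (by linarith)]
      ring
  have hfin : ∫⁻ t, ENNReal.ofReal (g t) ∂μ ≠ ∞ := hg.lintegral_lt_top.ne
  filter_upwards [(withDensity_eq_iff hm.ennreal_ofReal hm'.ennreal_ofReal hfin).1 heq]
    with t ht
  have := congrArg ENNReal.toReal ht
  simp only [ENNReal.toReal_ofReal'] at this
  rcases le_total 0 (g t) with h | h
  · rw [max_eq_left h, max_eq_right (by linarith)] at this
    exact this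
  · rw [max_eq_right h, max_eq_left (by linarith)] at this
    simpa using this.symm

/-- If all coefficients vanish, so does the transform, taken here with radius `1`. At points `z`
with `z / (z - 1) = iθ` the kernel is a nonzero constant times `exp (iθt)`, so the Fourier transform
of `φ` against the measure vanishes. -/
theorem eq_zero_of_integral_laguerreUnit {α : ℝ} (hα : 0 < α) (φ : Lp ℍ 2 (halfLineMeasure α))
    (h : ∀ n, ∫ t, star (laguerreUnit α n t) * φ t ∂(halfLineMeasure α) = 0) : φ = 0 := by
  have : Fact (0 < α) := ⟨hα⟩
  have hφ : Integrable φ (halfLineMeasure α) := (Lp.memLp φ).integrable (by norm_num)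
  have ht : ∀ q, transform 1 α φ q = 0 := fun q =>
    ((hasSum_transform one_pos hα φ q).unique (by simpa only [h, smul_zero, mul_zero] using
      hasSum_zero))
  obtain ⟨J, hJ, -⟩ := exists_eq_toSlice 0
  have hexp : ∀ θ : ℝ, ∫ t, toSlice J (Complex.exp (θ * t * Complex.I)) * φ t
      ∂(halfLineMeasure α) = 0 := by
    intro θ
    set w : ℂ := θ * Complex.I with hw
    have hw1 : w - 1 ≠ 0 := fun h0 => by
      have := congrArg Complex.re h0
      simp [hw] at this
    -- The map `w ↦ w / (w - 1)` is an involution, and it takes the imaginary axis into the unit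
    -- disc because `|iθ| < |iθ - 1|`.
    set z := w / (w - 1) with hz
    have hz1 : ‖z‖ < 1 := by
      rw [hz, norm_div, div_lt_one (norm_pos_iff.2 hw1), ← sq_lt_sq₀ (norm_nonneg _)
        (norm_nonneg _), ← Complex.normSq_eq_norm_sq, ← Complex.normSq_eq_norm_sq,
        Complex.normSq_apply, Complex.normSq_apply]
      simp [hw]
    have hzw : z / (z - 1) = w := by
      rw [hz]
      field_simp
      ring
    have hmem : toSlice J z ∈ ball (0 : ℍ) 1 := by
      rw [toSlice_mem_ball hJ]; simpa using hz1
    have h1 := ht ⟨_, hmem⟩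
    rw [transform_eq_integral one_pos φ hJ] at h1
    simp only [laguerreKernel, toSlice_mul hJ, mul_assoc, integral_quaternion_mul_left,
      Complex.ofReal_one, div_one] at h1
    have hne : toSlice J ((1 - z) ^ (-(α : ℂ) - 1)) ≠ 0 := by
      rw [← norm_ne_zero_iff, norm_toSlice hJ, norm_ne_zero_iff, Complex.cpow_ne_zero_iff]
      left
      intro h0
      rw [← sub_eq_zero.1 h0] at hz1
      simp at hz1
    rw [← (mul_eq_zero.1 h1).resolve_left hne]
    refine integral_congr_ae (Eventually.of_forall fun t => ?_)
    simp only
    congr 3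
    rw [mul_div_assoc, hzw, hw]
    ring
  have hcs : ∀ (θ t : ℝ), toSlice J (Complex.exp (θ * t * Complex.I)) =
      (Real.cos (θ * t) : ℍ) + Real.sin (θ * t) • J := by
    intro θ t
    rw [← Complex.ofReal_mul, toSlice, Complex.exp_ofReal_mul_I_re, Complex.exp_ofReal_mul_I_im]
  have h1 : ∀ θ : ℝ, Integrable (fun t => Real.cos (θ * t) • φ t) (halfLineMeasure α) := fun θ =>
    hφ.bdd_smul 1 (f := φ) (φ := fun t => Real.cos (θ * t))
      (by fun_prop) (Eventually.of_forall fun t => Real.abs_cos_le_one _)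
  have h2 : ∀ θ : ℝ, Integrable (fun t => Real.sin (θ * t) • φ t) (halfLineMeasure α) := fun θ =>
    hφ.bdd_smul 1 (f := φ) (φ := fun t => Real.sin (θ * t))
      (by fun_prop) (Eventually.of_forall fun t => Real.abs_sin_le_one _)
  have hsplit : ∀ θ : ℝ, (∫ t, Real.cos (θ * t) • φ t ∂(halfLineMeasure α)) +
      J * ∫ t, Real.sin (θ * t) • φ t ∂(halfLineMeasure α) = 0 := by
    intro θ
    rw [← integral_quaternion_mul_left, ← integral_add (h1 θ) ((h2 θ).const_mul J), ← hexp θ]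
    refine integral_congr_ae (Eventually.of_forall fun t => ?_)
    simp only
    rw [hcs, add_mul, Quaternion.coe_mul_eq_smul, smul_mul_assoc, mul_smul_comm]
  -- Both integrals are quaternions, so real and imaginary parts cannot be compared; parity in `θ`
  -- separates cosine from sine instead.
  have hsplit' : ∀ θ : ℝ, (∫ t, Real.cos (θ * t) • φ t ∂(halfLineMeasure α)) -
      J * ∫ t, Real.sin (θ * t) • φ t ∂(halfLineMeasure α) = 0 := by
    intro θ
    have := hsplit (-θ)
    simpa only [neg_mul, Real.cos_neg, Real.sin_neg, neg_smul, integral_neg, mul_neg,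
      ← sub_eq_add_neg] using this
  have hJ0 : J ≠ 0 := fun h0 => by
    have := (imagUnits_star hJ).2
    simp [h0] at this
  have hcos : ∀ θ : ℝ, ∫ t, Real.cos (θ * t) • φ t ∂(halfLineMeasure α) = 0 := by
    intro θ
    have := congrArg₂ (· + ·) (hsplit θ) (hsplit' θ)
    simp only [add_add_sub_cancel, add_zero] at this
    rw [← two_smul ℝ] at this
    exact (smul_eq_zero.1 this).resolve_left two_ne_zero
  have hsin : ∀ θ : ℝ, ∫ t, Real.sin (θ * t) • φ t ∂(halfLineMeasure α) = 0 := by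
    intro θ
    have := hsplit θ
    rw [hcos, zero_add] at this
    exact (mul_eq_zero.1 this).resolve_left hJ0
  have hzero : φ =ᵐ[halfLineMeasure α] 0 := by
    refine ae_eq_zero_of_forall_inner (𝕜 := ℝ) fun c => ?_
    refine ae_eq_zero_of_integral_cos_sin (hφ.const_inner c) (fun θ => ?_) fun θ => ?_
    · have := integral_inner (𝕜 := ℝ) (h1 θ) c
      simpa only [inner_smul_right, hcos, inner_zero_right] using this
    · have := integral_inner (𝕜 := ℝ) (h2 θ) c
      simpa only [inner_smul_right, hsin, inner_zero_right] using this
  exact (Lp.eq_zero_iff_ae_eq_zero).2 hzero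

end Completeness

/-! ### Exhausting the disc by smaller concentric discs. -/

section Limits

theorem tendsto_setIntegral_ball {E : Type*} [NormedAddCommGroup E] [NormedSpace ℝ E]
    {μ : Measure ℂ} {R : ℝ} {f : ℂ → E} (hf : IntegrableOn f (ball 0 R) μ) :
    Tendsto (fun r => ∫ z in ball 0 r, f z ∂μ) (𝓝[<] R) (𝓝 (∫ z in ball 0 R, f z ∂μ)) := by
  have h : ∀ r ≤ R, ∫ z in ball 0 r, f z ∂μ =
      ∫ z in ball 0 R, (ball (0 : ℂ) r).indicator f z ∂μ := fun r hr => by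
    rw [setIntegral_indicator measurableSet_ball, Set.inter_eq_right.2 (ball_subset_ball hr)]
  refine Tendsto.congr' (f₁ := fun r => ∫ z in ball 0 R, (ball (0 : ℂ) r).indicator f z ∂μ) ?_ ?_
  · filter_upwards [self_mem_nhdsWithin] with r hr
    exact (h r (le_of_lt hr)).symm
  · refine tendsto_integral_filter_of_dominated_convergence (fun z => ‖f z‖)
      (Eventually.of_forall fun r => hf.1.indicator measurableSet_ball)
      (Eventually.of_forall fun r => Eventually.of_forall fun z => norm_indicator_le_norm_self f z)
      hf.norm ?_
    filter_upwards [ae_restrict_mem measurableSet_ball] with z hz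
    refine tendsto_const_nhds.congr' ?_
    rw [mem_ball_zero_iff] at hz
    filter_upwards [mem_nhdsWithin_of_mem_nhds (lt_mem_nhds hz)] with r hr
    rw [Set.indicator_of_mem (by simpa using hr)]

theorem tendsto_toLp_indicator_ball {E : Type*} [NormedAddCommGroup E] [InnerProductSpace ℝ E]
    {μ : Measure ℂ} {R : ℝ} (hμ : ∀ᵐ z ∂μ, z ∈ ball (0 : ℂ) R) {f : ℂ → E} (hf : MemLp f 2 μ) :
    Tendsto (fun r : ℝ => (hf.indicator (measurableSet_ball (x := (0 : ℂ)) (ε := r))).toLp _)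
      (𝓝[<] R) (𝓝 (hf.toLp f)) := by
  rw [tendsto_iff_norm_sub_tendsto_zero]
  have hint := (memLp_two_iff_integrable_sq_norm hf.1).1 hf
  have h1 : ∀ r : ℝ, ‖(hf.indicator (measurableSet_ball (x := (0 : ℂ)) (ε := r))).toLp _ -
      hf.toLp f‖ = √(∫ z, ‖(ball (0 : ℂ) r).indicator f z - f z‖ ^ 2 ∂μ) := by
    intro r
    rw [← Real.sqrt_sq (norm_nonneg _), ← real_inner_self_eq_norm_sq, L2.inner_def]
    congr 1
    refine integral_congr_ae ?_
    filter_upwards [Lp.coeFn_sub ((hf.indicator (measurableSet_ball (x := (0 : ℂ))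
      (ε := r))).toLp _) (hf.toLp f), hf.coeFn_toLp,
      (hf.indicator (measurableSet_ball (x := (0 : ℂ)) (ε := r))).coeFn_toLp] with z hz1 hz2 hz3
    rw [hz1, Pi.sub_apply, hz2, hz3, real_inner_self_eq_norm_sq]
  simp_rw [h1]
  rw [← Real.sqrt_zero]
  refine (Real.continuous_sqrt.tendsto 0).comp ?_
  rw [← integral_zero ℂ ℝ (μ := μ)]
  refine tendsto_integral_filter_of_dominated_convergence (fun z => ‖f z‖ ^ 2)
    (Eventually.of_forall fun r =>
      (((hf.1.indicator measurableSet_ball).sub hf.1).norm.pow 2))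
    (Eventually.of_forall fun r => Eventually.of_forall fun z => ?_) hint ?_
  · rw [norm_pow, norm_norm]
    by_cases hz : z ∈ ball (0 : ℂ) r
    · rw [Set.indicator_of_mem hz, sub_self, norm_zero, zero_pow two_ne_zero]
      exact sq_nonneg _
    · rw [Set.indicator_of_notMem hz, zero_sub, norm_neg]
  · filter_upwards [hμ] with z hz
    refine tendsto_const_nhds.congr' ?_
    rw [mem_ball_zero_iff] at hz
    filter_upwards [mem_nhdsWithin_of_mem_nhds (lt_mem_nhds hz)] with r hr
    rw [Set.indicator_of_mem (by simpa using hr)]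
    simp

end Limits

/-! ### Taylor coefficients as Fourier coefficients. -/

section Coefficients

variable {R α : ℝ} {I : ℍ} (hR : 0 < R) (hα : 0 < α) (hI : I ∈ imagUnits)
include hR hα hI

omit hR hα in
theorem monomialUnit_eq (n : ℕ) (z : ℂ) : monomialUnit R α I n z =
    (√(Ring.multichoose (α + 1) n) / R ^ n) • toSlice I z ^ n := by
  have h : (√(Ring.multichoose (α + 1) n) : ℂ) * (z / R) ^ n =
      ((√(Ring.multichoose (α + 1) n) / R ^ n : ℝ) : ℂ) * z ^ n := by
    push_cast
    rw [div_pow]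
    ring
  rw [monomialUnit, h, toSlice_mul hI, toSlice_ofReal, Quaternion.coe_mul_eq_smul, toSlice_pow hI]

/-- The weighted Taylor coefficients of a square integrable power series on the disc are its
Fourier coefficients with respect to the normalized monomials. -/
theorem integral_star_monomialUnit_mul {c : ℕ → ℍ} {g : ℂ → ℍ}
    (hg : MemLp g 2 (discMeasure R α))
    (hc : ∀ r, 0 ≤ r → r < R → Summable fun n => ‖c n‖ * r ^ n)
    (hsum : ∀ z ∈ ball (0 : ℂ) R, HasSum (fun n => toSlice I z ^ n * c n) (g z)) (n : ℕ) :
    ∫ z, star (monomialUnit R α I n z) * g z ∂(discMeasure R α) =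
      (R ^ n / √(Ring.multichoose (α + 1) n)) • c n := by
  have hw := monomialUnit_orthonormal hR hα hI
  have hprob := isProbabilityMeasure_disc hR hα
  set s : ℕ → ℝ := fun k => R ^ k / √(Ring.multichoose (α + 1) k) with hs
  have hpow : ∀ k z, toSlice I z ^ k = s k • monomialUnit R α I k z := by
    intro k z
    have hpos := Real.sqrt_pos.2 (multichoose_pos (a := α + 1) (by positivity) k)
    have : s k * (√(Ring.multichoose (α + 1) k) / R ^ k) = 1 := by
      simp only [hs]
      field_simp
    rw [monomialUnit_eq hI, smul_smul, this, one_smul]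
  have hint1 := integrable_star_mul (hw.memLp n) hg
  have hint2 := integrable_star_mul (hw.memLp n) (hw.memLp n)
  -- Only for `r < R` is the power series known to be integrable term by term; orthogonality on the
  -- smaller disc leaves the `n`-th term, and then `r → R`.
  have hr : ∀ r < R, ∫ z in ball 0 r, star (monomialUnit R α I n z) * g z ∂(discMeasure R α) =
      (∫ z in ball 0 r, star (monomialUnit R α I n z) * monomialUnit R α I n z
        ∂(discMeasure R α)) * (s n • c n) := by
    intro r hrR
    set F : ℕ → ℂ → ℍ := fun k z => star (monomialUnit R α I n z) * (toSlice I z ^ k * c k) with hF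
    have hFc : ∀ k, Continuous (F k) := fun k =>
      (continuous_quaternion_star.comp (continuous_monomialUnit n)).mul
        (((continuous_toSlice I).pow k).mul continuous_const)
    have hFi : ∀ k, Integrable (F k) ((discMeasure R α).restrict (ball 0 r)) := fun k =>
      (integrable_disc_of_continuous hR hα (hFc k)).restrict
    have hwn : Integrable (fun z => ‖monomialUnit R α I n z‖) (discMeasure R α) :=
      integrable_disc_of_continuous hR hα (continuous_monomialUnit n).norm
    have hFs : Summable fun k => ∫ z in ball 0 r, ‖F k z‖ ∂(discMeasure R α) := by
      refine Summable.of_nonneg_of_le (fun k => integral_nonneg fun z => norm_nonneg _)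
        -- The radius `r` may be negative, with an empty disc, hence `max r 0`.
        (fun k => ?_) ((hc (max r 0) (le_max_right _ _) (max_lt hrR hR)).mul_right
          (∫ z in ball 0 r, ‖monomialUnit R α I n z‖ ∂(discMeasure R α)))
      rw [← integral_const_mul]
      refine setIntegral_mono_on (hFi k).norm (hwn.restrict.const_mul _) measurableSet_ball
        fun z hz => ?_
      rw [mem_ball_zero_iff] at hz
      simp only [hF, norm_mul, Quaternion.norm_star, norm_pow, norm_toSlice hI]
      have : ‖z‖ ^ k ≤ max r 0 ^ k := by
        gcongr
        exact hz.le.trans (le_max_left _ _)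
      calc _ ≤ ‖monomialUnit R α I n z‖ * (max r 0 ^ k * ‖c k‖) := by gcongr
        _ = _ := by ring
    have h := hasSum_integral_of_summable_integral_norm hFi hFs
    have hval : ∫ z in ball 0 r, ∑' k, F k z ∂(discMeasure R α) =
        ∫ z in ball 0 r, star (monomialUnit R α I n z) * g z ∂(discMeasure R α) := by
      refine setIntegral_congr_fun measurableSet_ball fun z hz => ?_
      exact ((hsum z (ball_subset_ball hrR.le hz)).mul_left _).tsum_eq
    rw [hval] at h
    have hterm : ∀ k, ∫ z in ball 0 r, F k z ∂(discMeasure R α) =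
        (∫ z in ball 0 r, star (monomialUnit R α I n z) * monomialUnit R α I k z
          ∂(discMeasure R α)) * (s k • c k) := by
      intro k
      rw [← integral_quaternion_mul_right]
      simp only [hF, hpow, smul_mul_assoc, mul_smul_comm, mul_assoc]
    refine h.unique (hasSum_of_eq (hasSum_single n fun k hk => ?_) hterm rfl)
    rw [setIntegral_star_monomialUnit_mul hR hα hI hk.symm hrR.le, zero_mul]
  have hl := tendsto_setIntegral_ball (R := R) hint1.integrableOn
  have hl2 := (tendsto_setIntegral_ball (R := R) hint2.integrableOn).mul_const (s n • c n)
  rw [discMeasure_restrict_self] at hl hl2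
  rw [hw.integral_star_mul, if_pos rfl, one_mul] at hl2
  refine tendsto_nhds_unique hl (hl2.congr' ?_)
  filter_upwards [self_mem_nhdsWithin] with r hrR
  exact (hr r hrR).symm

end Coefficients

/-! ### The transform and its adjoint on `L²`, and the bijection onto the Bergman space. -/

section Operators

variable {R α : ℝ} {I : ℍ} (hR : 0 < R) (hα : 0 < α) (hI : I ∈ imagUnits)

/-- The transform as an operator between `L²` spaces. -/
def transformL2 : Lp ℍ 2 (halfLineMeasure α) →L[ℝ] Lp ℍ 2 (discMeasure R α) :=
  (monomialUnit_orthonormal hR hα hI).synth.toContinuousLinearMap ∘L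
    (laguerreUnit_orthonormal hα).coeff

/-- The adjoint of the transform as an operator between `L²` spaces. -/
def adjointL2 : Lp ℍ 2 (discMeasure R α) →L[ℝ] Lp ℍ 2 (halfLineMeasure α) :=
  (laguerreUnit_orthonormal hα).synth.toContinuousLinearMap ∘L
    (monomialUnit_orthonormal hR hα hI).coeff

theorem transformL2_apply (φ : Lp ℍ 2 (halfLineMeasure α)) : transformL2 hR hα hI φ =
    (monomialUnit_orthonormal hR hα hI).synth ((laguerreUnit_orthonormal hα).coeff φ) := rfl

theorem adjointL2_apply (g : Lp ℍ 2 (discMeasure R α)) : adjointL2 hR hα hI g =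
    (laguerreUnit_orthonormal hα).synth ((monomialUnit_orthonormal hR hα hI).coeff g) := rfl

theorem adjointL2_transformL2 (φ : Lp ℍ 2 (halfLineMeasure α)) :
    adjointL2 hR hα hI (transformL2 hR hα hI φ) = φ := by
  rw [adjointL2_apply, transformL2_apply, QOrthonormal.coeff_synth, QOrthonormal.synth_coeff]
  exact eq_zero_of_integral_laguerreUnit hα

theorem inner_transformL2 (φ : Lp ℍ 2 (halfLineMeasure α)) (g : Lp ℍ 2 (discMeasure R α)) :
    inner ℝ (transformL2 hR hα hI φ) g = inner ℝ φ (adjointL2 hR hα hI g) := by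
  rw [transformL2_apply, adjointL2_apply, ← QOrthonormal.inner_coeff, real_inner_comm,
    ← real_inner_comm φ, ← QOrthonormal.inner_coeff]

/-- On the whole `L²` of the disc the composite is only the projection onto the closed span of the
monomials, so equality holds for coefficients and not for `g` itself. -/
theorem coeff_transformL2_adjointL2 (g : Lp ℍ 2 (discMeasure R α)) :
    (monomialUnit_orthonormal hR hα hI).coeff (transformL2 hR hα hI (adjointL2 hR hα hI g)) =
      (monomialUnit_orthonormal hR hα hI).coeff g := by
  rw [transformL2_apply, adjointL2_apply, QOrthonormal.coeff_synth, QOrthonormal.coeff_synth]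

theorem transformL2_ae_eq (φ : Lp ℍ 2 (halfLineMeasure α)) :
    transformL2 hR hα hI φ =ᵐ[discMeasure R α] restrictSlice I (transform R α φ) := by
  refine QOrthonormal.synth_ae_eq _ _ ?_
  filter_upwards [ae_mem_ball_discMeasure] with z hz
  have hz' := (toSlice_mem_ball hI).2 hz
  rw [restrictSlice, extendBall_of_mem _ hz']
  refine hasSum_of_eq (hasSum_transform hR hα φ ⟨_, hz'⟩) (fun n => ?_) rfl
  refine (congrArg (monomialUnit R α I n z * ·)
    ((laguerreUnit_orthonormal hα).coeff_apply φ n)).trans ?_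
  simp only
  rw [monomialUnit_eq hI, smul_mul_assoc, mul_smul_comm]

include hR hα hI

theorem transform_mem_bergmanSpace (φ : Lp ℍ 2 (halfLineMeasure α)) :
    transform R α φ ∈ bergmanSpace R α I :=
  ⟨isSliceRegular_transform hR hα φ,
    (memLp_congr_ae (transformL2_ae_eq hR hα hI φ)).1 (Lp.memLp _)⟩

theorem toLp_restrictSlice_transform (φ : Lp ℍ 2 (halfLineMeasure α)) :
    (transform_mem_bergmanSpace hR hα hI φ).2.toLp _ = transformL2 hR hα hI φ :=
  Lp.ext ((MemLp.coeFn_toLp _).trans (transformL2_ae_eq hR hα hI φ).symm)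

/-- Both sides are power series on the ball whose restrictions to the slice have the same pairings
with the monomials, hence the same Taylor coefficients. -/
theorem transform_adjointL2 {f : ball (0 : ℍ) R → ℍ} (hf : f ∈ bergmanSpace R α I) :
    transform R α (adjointL2 hR hα hI (hf.2.toLp _)) = f := by
  set φ := adjointL2 hR hα hI (hf.2.toLp _) with hφ
  obtain ⟨a, ha⟩ := hasSum_of_isSliceRegular hR hf.1
  obtain ⟨b, hb⟩ := hasSum_of_isSliceRegular hR (isSliceRegular_transform hR hα φ)
  have hw := monomialUnit_orthonormal hR hα hI
  have hmem := (transform_mem_bergmanSpace hR hα hI φ).2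
  have hz : ∀ {h : ball (0 : ℍ) R → ℍ} {c : ℕ → ℍ},
      (∀ q : ball (0 : ℍ) R, HasSum (fun n => (q : ℍ) ^ n * c n) (h q)) →
      ∀ z ∈ ball (0 : ℂ) R, HasSum (fun n => toSlice I z ^ n * c n) (restrictSlice I h z) := by
    intro h c hc z hz
    have hz' := (toSlice_mem_ball hI).2 hz
    rw [restrictSlice, extendBall_of_mem _ hz']
    exact hc ⟨_, hz'⟩
  have hab : a = b := by
    funext n
    have h1 := integral_star_monomialUnit_mul hR hα hI hf.2 (summable_coeff_of_hasSum ha)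
      (hz ha) n
    have h2 := integral_star_monomialUnit_mul hR hα hI hmem (summable_coeff_of_hasSum hb)
      (hz hb) n
    have h3 : ∀ {g : ℂ → ℍ} (hg : MemLp g 2 (discMeasure R α)),
        ∫ z, star (monomialUnit R α I n z) * g z ∂(discMeasure R α) = hw.coeff (hg.toLp g) n := by
      intro g hg
      rw [hw.coeff_apply]
      refine integral_congr_ae ?_
      filter_upwards [hg.coeFn_toLp] with z hz
      rw [hz]
    rw [h3 hf.2] at h1
    rw [h3 hmem, toLp_restrictSlice_transform hR hα hI, hφ, coeff_transformL2_adjointL2, h1] at h2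
    have hpos := Real.sqrt_pos.2 (multichoose_pos (a := α + 1) (by positivity) n)
    exact smul_right_injective ℍ (by positivity) h2
  subst hab
  exact funext fun q => (hb q).unique (ha q)

/-- The transform as a bijection of `L²` onto the Bergman space. -/
def transformEquiv : Lp ℍ 2 (halfLineMeasure α) ≃ bergmanSpace R α I where
  toFun φ := ⟨transform R α φ, transform_mem_bergmanSpace hR hα hI φ⟩
  invFun f := adjointL2 hR hα hI (f.2.2.toLp _)
  left_inv φ := (congrArg (adjointL2 hR hα hI) (toLp_restrictSlice_transform hR hα hI φ)).trans
    (adjointL2_transformL2 hR hα hI φ)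
  right_inv f := Subtype.ext (transform_adjointL2 hR hα hI f.2)

omit hR hα hI in
theorem transform_toLp_mul_right (φ : Lp ℍ 2 (halfLineMeasure α)) (a : ℍ) (q : ball (0 : ℍ) R) :
    transform R α ((memLp_mul_right (Lp.memLp φ) a).toLp _) q = transform R α φ q * a := by
  rw [transform, transform, mul_assoc, ← integral_quaternion_mul_right]
  congr 1
  refine integral_congr_ae ?_
  filter_upwards [(memLp_mul_right (Lp.memLp φ) a).coeFn_toLp] with t ht
  rw [ht, mul_assoc]

/-- The transform commutes with right multiplication by quaternions, so the real adjoint relation,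
tested on all `φ * a`, upgrades to the quaternionic one. -/
theorem integral_star_transform_mul {f : ball (0 : ℍ) R → ℍ} (hf : f ∈ bergmanSpace R α I)
    (φ : Lp ℍ 2 (halfLineMeasure α)) :
    ∫ z, star (restrictSlice I (transform R α φ) z) * restrictSlice I f z ∂(discMeasure R α) =
      ∫ t, star (φ t) * adjointL2 hR hα hI (hf.2.toLp _) t ∂(halfLineMeasure α) := by
  have hmem := (transform_mem_bergmanSpace hR hα hI φ).2
  have h1 : ∫ z, star (restrictSlice I (transform R α φ) z) * restrictSlice I f z
      ∂(discMeasure R α) = ∫ z, star (restrictSlice I (transform R α φ) z) * hf.2.toLp _ z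
        ∂(discMeasure R α) := by
    refine integral_congr_ae ?_
    filter_upwards [hf.2.coeFn_toLp] with z hz
    rw [hz]
  rw [h1]
  refine ext_inner_left ℝ fun a => ?_
  rw [← inner_toLp_mul_right hmem, ← inner_toLp_mul_right (Lp.memLp φ), ← inner_transformL2]
  congr 1
  refine Lp.ext ?_
  filter_upwards [(memLp_mul_right hmem a).coeFn_toLp,
    transformL2_ae_eq hR hα hI ((memLp_mul_right (Lp.memLp φ) a).toLp _),
    ae_mem_ball_discMeasure] with z hz1 hz2 hz3
  have hz' := (toSlice_mem_ball hI).2 hz3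
  rw [hz1, hz2, restrictSlice, restrictSlice, extendBall_of_mem _ hz', extendBall_of_mem _ hz',
    transform_toLp_mul_right]

end Operators

/-! ### The inversion integral. -/

section Inversion

variable {R α : ℝ} {I : ℍ} (hR : 0 < R) (hα : 0 < α) (hI : I ∈ imagUnits)

/-- The integrand of the inversion formula with respect to the weighted measure of the disc. -/
def inversionKernel (R α : ℝ) (I : ℍ) (t : ℝ) (z : ℂ) : ℍ :=
  toSlice I (laguerreKernel α t (star z / R))

theorem measurable_laguerreKernel (α t : ℝ) : Measurable (laguerreKernel α t) := by
  unfold laguerreKernel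
  fun_prop

theorem aestronglyMeasurable_inversionKernel (t : ℝ) (μ : Measure ℂ) :
    AEStronglyMeasurable (inversionKernel R α I t) μ := by
  have h : Measurable fun z : ℂ => laguerreKernel α t (star z / R) :=
    (measurable_laguerreKernel α t).comp ((continuous_star.div_const _).measurable)
  exact (continuous_toSlice I).comp_aestronglyMeasurable h.aestronglyMeasurable

include hR in
theorem norm_star_div_lt_one {z : ℂ} (hz : ‖z‖ < R) : ‖star z / (R : ℂ)‖ < 1 := by
  rw [norm_div, norm_star, Complex.norm_real, Real.norm_of_nonneg hR.le, div_lt_one hR]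
  exact hz

include hR hI in
-- The exponential and the power both lie in `ℂ_I`, so they commute, and the real weight passes into
-- the density.
theorem smul_invIntegrand (f : ball (0 : ℍ) R → ℍ) (t : ℝ) {z : ℂ} (hz : z ∈ ball (0 : ℂ) R) :
    (α / (Real.pi * R ^ 2)) • invIntegrand R α I f t z =
      discDensity R α z • (inversionKernel R α I t z * restrictSlice I f z) := by
  have hz' : ‖star z‖ < R := by rwa [norm_star, ← mem_ball_zero_iff]
  have h1 : 0 < (1 - star z / R).re := by
    have h4 : (star z / (R : ℂ)).re ≤ ‖star z / (R : ℂ)‖ := Complex.re_le_norm _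
    have h5 := norm_star_div_lt_one hR (z := z) (by simpa using hz)
    rw [Complex.sub_re, Complex.one_re]
    linarith
  have h2 : 1 - toSlice I (star z) / (R : ℍ) = toSlice I (1 - star z / R) := by
    rw [toSlice_sub, toSlice_one hI, toSlice_div hI, toSlice_ofReal]
  have h3 : (t : ℍ) * toSlice I (star z) / (toSlice I (star z) - (R : ℍ)) =
      toSlice I (t * star z / (star z - R)) := by
    rw [toSlice_div hI, toSlice_mul hI, toSlice_sub, toSlice_ofReal, toSlice_ofReal]
  have hk := qpow_mul_exp_eq (α := α) hR hI t hz'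
  have hcomm : qpow (1 - toSlice I (star z) / (R : ℍ)) (-α - 1) *
      NormedSpace.exp ((t : ℍ) * toSlice I (star z) / (toSlice I (star z) - (R : ℍ))) =
      NormedSpace.exp ((t : ℍ) * toSlice I (star z) / (toSlice I (star z) - (R : ℍ))) *
        qpow (1 - toSlice I (star z) / (R : ℍ)) (-α - 1) := by
    rw [h2, h3, qpow_toSlice hI _ h1, ← toSlice_exp hI, ← toSlice_mul hI, ← toSlice_mul hI,
      mul_comm]
  rw [hcomm] at hk
  simp only [invIntegrand, inversionKernel, discDensity, toSlice_star hI, norm_toSlice hI]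
  rw [Quaternion.mul_coe_eq_smul, smul_mul_assoc, smul_mul_assoc, hk, smul_smul]

include hR hα hI

theorem invIntegral_eq (f : ball (0 : ℍ) R → ℍ) {r : ℝ} (hr : r ≤ R) (t : ℝ) :
    invIntegral R α I f r t =
      ∫ z in ball 0 r, inversionKernel R α I t z * restrictSlice I f z ∂(discMeasure R α) := by
  rw [invIntegral, ← integral_smul, setIntegral_disc hR hα _ hr]
  exact setIntegral_congr_fun measurableSet_ball fun z hz =>
    smul_invIntegrand hR hI f t (ball_subset_ball hr hz)

theorem integrableOn_invIntegrand_iff (f : ball (0 : ℍ) R → ℍ) {r : ℝ} (hr : r ≤ R) (t : ℝ) :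
    IntegrableOn (invIntegrand R α I f t) (ball 0 r) ↔
      IntegrableOn (fun z => inversionKernel R α I t z * restrictSlice I f z) (ball 0 r)
        (discMeasure R α) := by
  have hc : α / (Real.pi * R ^ 2) ≠ 0 := by positivity
  rw [integrableOn_disc_iff hR hα _ hr, IntegrableOn, ← integrable_smul_iff hc]
  exact integrableOn_congr_fun (fun z hz => smul_invIntegrand hR hI f t (ball_subset_ball hr hz))
    measurableSet_ball

omit hR hα hI in
theorem hasSum_inversionKernel (hR : 0 < R) (hα : 0 < α) (hI : I ∈ imagUnits) (t : ℝ) {z : ℂ}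
    (hz : ‖z‖ < R) : HasSum (fun n => laguerreUnit α n t * star (monomialUnit R α I n z))
      (inversionKernel R α I t z) := by
  refine hasSum_of_eq (hasSum_toSlice hI (hasSum_laguerre hα t (norm_star_div_lt_one hR hz)))
    (fun n => ?_) rfl
  have hpos := Real.sqrt_pos.2 (multichoose_pos (a := α + 1) (by positivity) n)
  rw [monomialUnit, toSlice_star hI, laguerreUnit, ← toSlice_ofReal I, ← toSlice_mul hI]
  congr 1
  simp only [star_mul', star_pow, star_div₀, Complex.star_def, Complex.conj_ofReal]
  push_cast
  have : (√(Ring.multichoose (α + 1) n) : ℂ) ≠ 0 := by exact_mod_cast hpos.ne'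
  field_simp

omit hR hI in
theorem summable_laguerre_mul_pow (t : ℝ) {ρ : ℝ} (h0 : 0 ≤ ρ) (h1 : ρ < 1) :
    Summable fun n => |laguerre α n t| * ρ ^ n := by
  have h := (hasSum_laguerre hα t (z := (ρ : ℂ)) (by simpa [abs_of_nonneg h0] using h1)).summable
  refine h.norm.congr fun n => ?_
  rw [norm_mul, norm_pow, Complex.norm_real, Complex.norm_real, Real.norm_of_nonneg h0,
    Real.norm_eq_abs, mul_comm]

theorem norm_laguerreUnit_mul_star_monomialUnit (t : ℝ) (n : ℕ) (z : ℂ) :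
    ‖laguerreUnit α n t * star (monomialUnit R α I n z)‖ =
      |laguerre α n t| * (‖z‖ / R) ^ n := by
  have hpos := Real.sqrt_pos.2 (multichoose_pos (a := α + 1) (by positivity) n)
  rw [norm_mul, Quaternion.norm_star, monomialUnit, norm_toSlice hI, laguerreUnit,
    Quaternion.norm_coe, norm_div, norm_mul, norm_pow, norm_div, Complex.norm_real,
    Complex.norm_real, Real.norm_of_nonneg hpos.le, Real.norm_of_nonneg hR.le, Real.norm_eq_abs]
  field_simp

theorem integrableOn_inversionKernel_mul {g : ℂ → ℍ} (hg : Integrable g (discMeasure R α))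
    {r : ℝ} (hr : r < R) (t : ℝ) :
    IntegrableOn (fun z => inversionKernel R α I t z * g z) (ball 0 r) (discMeasure R α) := by
  have hs := summable_laguerre_mul_pow hα t (ρ := max r 0 / R) (by positivity)
    ((div_lt_one hR).2 (max_lt hr hR))
  refine hg.integrableOn.bdd_mul (c := ∑' n, |laguerre α n t| * (max r 0 / R) ^ n)
    (aestronglyMeasurable_inversionKernel t _) ?_
  filter_upwards [ae_restrict_mem measurableSet_ball] with z hz
  rw [mem_ball_zero_iff] at hz
  have h := hasSum_inversionKernel hR hα hI t (hz.trans hr)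
  rw [← h.tsum_eq]
  refine tsum_of_norm_bounded hs.hasSum fun n => ?_
  rw [norm_laguerreUnit_mul_star_monomialUnit hR hα hI]
  gcongr
  exact hz.le.trans (le_max_left _ _)

theorem hasSum_setIntegral_inversionKernel_mul {g : ℂ → ℍ} (hg : MemLp g 2 (discMeasure R α))
    {r : ℝ} (hr : r < R) (t : ℝ) :
    HasSum (fun n => laguerreUnit α n t *
        ∫ z in ball 0 r, star (monomialUnit R α I n z) * g z ∂(discMeasure R α))
      (∫ z in ball 0 r, inversionKernel R α I t z * g z ∂(discMeasure R α)) := by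
  have hprob := isProbabilityMeasure_disc hR hα
  have hg1 : Integrable g (discMeasure R α) := hg.integrable (by norm_num)
  have hw := monomialUnit_orthonormal hR hα hI
  have hs := summable_laguerre_mul_pow hα t (ρ := max r 0 / R) (by positivity)
    ((div_lt_one hR).2 (max_lt hr hR))
  have hint : ∀ n, Integrable (fun z => laguerreUnit α n t *
      (star (monomialUnit R α I n z) * g z)) ((discMeasure R α).restrict (ball 0 r)) := fun n =>
    ((integrable_star_mul (hw.memLp n) hg).const_mul _).restrict
  have hsum : Summable fun n => ∫ z in ball 0 r, ‖laguerreUnit α n t *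
      (star (monomialUnit R α I n z) * g z)‖ ∂(discMeasure R α) := by
    refine Summable.of_nonneg_of_le (fun n => integral_nonneg fun z => norm_nonneg _)
      (fun n => ?_) (hs.mul_right (∫ z in ball 0 r, ‖g z‖ ∂(discMeasure R α)))
    rw [← integral_const_mul]
    refine setIntegral_mono_on (hint n).norm (hg1.norm.restrict.const_mul _) measurableSet_ball
      fun z hz => ?_
    rw [mem_ball_zero_iff] at hz
    rw [← mul_assoc, norm_mul, norm_laguerreUnit_mul_star_monomialUnit hR hα hI]
    gcongr
    exact hz.le.trans (le_max_left _ _)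
  refine hasSum_of_eq (hasSum_integral_of_summable_integral_norm hint hsum)
    (fun n => (integral_quaternion_mul_left _ _).symm) ?_
  refine setIntegral_congr_fun measurableSet_ball fun z hz => ?_
  rw [mem_ball_zero_iff] at hz
  simp only [← mul_assoc]
  exact ((hasSum_inversionKernel hR hα hI t (hz.trans hr)).mul_right (g z)).tsum_eq.symm

/-- The monomial coefficients of the truncated function are integrals over the smaller disc, where
the kernel series can be integrated term by term. -/
theorem adjointL2_indicator_ae_eq {f : ball (0 : ℍ) R → ℍ} (hf : f ∈ bergmanSpace R α I)
    {r : ℝ} (hr : r < R) :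
    adjointL2 hR hα hI ((hf.2.indicator (measurableSet_ball (x := (0 : ℂ)) (ε := r))).toLp _)
      =ᵐ[halfLineMeasure α] invIntegral R α I f r := by
  refine QOrthonormal.synth_ae_eq _ _ (Eventually.of_forall fun t => ?_)
  rw [invIntegral_eq hR hα hI f hr.le]
  refine hasSum_of_eq (hasSum_setIntegral_inversionKernel_mul hR hα hI hf.2 hr t) (fun n => ?_) rfl
  refine congrArg (laguerreUnit α n t * ·)
    (((monomialUnit_orthonormal hR hα hI).coeff_apply _ n).trans ?_)
  rw [← integral_indicator measurableSet_ball]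
  refine integral_congr_ae ?_
  filter_upwards [(hf.2.indicator (measurableSet_ball (x := (0 : ℂ)) (ε := r))).coeFn_toLp]
    with z hz
  rw [hz]
  by_cases h : z ∈ ball (0 : ℂ) r
  · rw [Set.indicator_of_mem h, Set.indicator_of_mem h]
  · rw [Set.indicator_of_notMem h, Set.indicator_of_notMem h, mul_zero]

theorem integrableOn_invIntegrand {f : ball (0 : ℍ) R → ℍ} (hf : f ∈ bergmanSpace R α I)
    {r : ℝ} (hr : r < R) (t : ℝ) : IntegrableOn (invIntegrand R α I f t) (ball 0 r) := by
  have hprob := isProbabilityMeasure_disc hR hα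
  rw [integrableOn_invIntegrand_iff hR hα hI f hr.le]
  exact integrableOn_inversionKernel_mul hR hα hI (hf.2.integrable (by norm_num)) hr t

theorem memLp_invIntegral {f : ball (0 : ℍ) R → ℍ} (hf : f ∈ bergmanSpace R α I)
    {r : ℝ} (hr : r < R) : MemLp (invIntegral R α I f r) 2 (halfLineMeasure α) :=
  (memLp_congr_ae (adjointL2_indicator_ae_eq hR hα hI hf hr)).1 (Lp.memLp _)

theorem tendsto_eLpNorm_invIntegral {f : ball (0 : ℍ) R → ℍ} (hf : f ∈ bergmanSpace R α I) :
    Tendsto (fun r : ℝ => eLpNorm (fun t => invIntegral R α I f r t -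
        adjointL2 hR hα hI (hf.2.toLp _) t) 2 (halfLineMeasure α)) (𝓝[<] R) (𝓝 0) := by
  have h := ((adjointL2 hR hα hI).continuous.tendsto _).comp
    (tendsto_toLp_indicator_ball ae_mem_ball_discMeasure hf.2)
  rw [Lp.tendsto_Lp_iff_tendsto_eLpNorm'] at h
  refine h.congr' ?_
  filter_upwards [self_mem_nhdsWithin] with r hr
  refine eLpNorm_congr_ae ?_
  filter_upwards [adjointL2_indicator_ae_eq hR hα hI hf hr] with t ht
  rw [Pi.sub_apply, Function.comp, ht]

/-- Along some sequence of radii the `L²` limit is also an almost everywhere limit; where the full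
integral converges absolutely, dominated convergence identifies that limit. -/
theorem ae_adjointL2_eq_invIntegral {f : ball (0 : ℍ) R → ℍ} (hf : f ∈ bergmanSpace R α I) :
    ∀ᵐ t ∂(halfLineMeasure α), IntegrableOn (invIntegrand R α I f t) (ball (0 : ℂ) R) →
      adjointL2 hR hα hI (hf.2.toLp _) t = invIntegral R α I f R t := by
  obtain ⟨r, hrlt, hr⟩ : ∃ r : ℕ → ℝ, (∀ i, r i < R) ∧ Tendsto r atTop (𝓝[<] R) := by
    obtain ⟨r, -, hlt, ht⟩ := exists_seq_strictMono_tendsto R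
    exact ⟨r, hlt, tendsto_nhdsWithin_iff.2 ⟨ht, Eventually.of_forall hlt⟩⟩
  have hmeas := tendstoInMeasure_of_tendsto_eLpNorm two_ne_zero
    (fun i => (memLp_invIntegral hR hα hI hf (hrlt i)).1) (Lp.aestronglyMeasurable _)
    ((tendsto_eLpNorm_invIntegral hR hα hI hf).comp hr)
  obtain ⟨ns, hns, hlim⟩ := hmeas.exists_seq_tendsto_ae
  filter_upwards [hlim] with t ht hint
  refine tendsto_nhds_unique ht ?_
  exact ((tendsto_setIntegral_ball hint).const_smul (α / (Real.pi * R ^ 2))).comp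
    (hr.comp hns.tendsto_atTop)

end Inversion

end SliceBergman

end

theorem mainTheorem6 (R α : ℝ) (hR : 0 < R) (hα : 0 < α)
    (I : ℍ) (hI : I ∈ SliceBergman.imagUnits) :
    -- the transform is a bijection `e` of `L²` onto the Bergman space, and its inverse `e.symm`:
    ∃ e : Lp ℍ 2 (SliceBergman.halfLineMeasure α) ≃ SliceBergman.bergmanSpace R α I,
      (∀ φ, (e φ : ball (0 : ℍ) R → ℍ) = SliceBergman.transform R α φ) ∧
      (∀ f : SliceBergman.bergmanSpace R α I,
        -- is given by the integral, in the sense of convergence in `L²`,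
        (∀ r < R,
          (∀ t > 0, IntegrableOn (SliceBergman.invIntegrand R α I f t) (ball (0 : ℂ) r)) ∧
          MemLp (SliceBergman.invIntegral R α I f r) 2 (SliceBergman.halfLineMeasure α)) ∧
        Tendsto (fun r : ℝ =>
            eLpNorm (fun t => SliceBergman.invIntegral R α I f r t - e.symm f t) 2
              (SliceBergman.halfLineMeasure α))
          (𝓝[<] R) (𝓝 0) ∧
        -- and by the plain integral at almost every `t` for which it converges absolutely;
        (∀ᵐ t ∂(SliceBergman.halfLineMeasure α),
          IntegrableOn (SliceBergman.invIntegrand R α I f t) (ball (0 : ℂ) R) →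
            e.symm f t = SliceBergman.invIntegral R α I f R t) ∧
        -- moreover the inverse is the adjoint of the transform
        (∀ φ : Lp ℍ 2 (SliceBergman.halfLineMeasure α),
          ∫ z, star (SliceBergman.restrictSlice I (SliceBergman.transform R α φ) z) *
              SliceBergman.restrictSlice I (f : ball (0 : ℍ) R → ℍ) z
                ∂(SliceBergman.discMeasure R α) =
            ∫ t, star (φ t) * e.symm f t ∂(SliceBergman.halfLineMeasure α))) := by
  refine ⟨SliceBergman.transformEquiv hR hα hI, fun φ => rfl, fun f =>
    ⟨fun r hr => ⟨fun t _ => SliceBergman.integrableOn_invIntegrand hR hα hI f.2 hr t,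
      SliceBergman.memLp_invIntegral hR hα hI f.2 hr⟩,
      SliceBergman.tendsto_eLpNorm_invIntegral hR hα hI f.2,
      SliceBergman.ae_adjointL2_eq_invIntegral hR hα hI f.2,
      fun φ => SliceBergman.integral_star_transform_mul hR hα hI f.2 φ⟩⟩
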